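/- **Conventions.** A Lévy process in $\mathbb R^m$ is a process $(X(t))_{t\ge 0}$ with $X(0)=0$ a.s., independent and stationary increments, and a.s. càdlàg paths. Write $X\sim L^m(\mu,\Sigma,\mathcal X)$ if it has characteristic triplet $(\mu,\Sigma,\mathcal X)$ (with $\mu\in\mathbb R^m$, $\Sigma$ a covariance matrix, $\mathcal X$ a Lévy measure on $\mathbb R^m\setminus\{0\}$), i.e. $\mathbb E e^{i\langle\theta,X(t)\rangle}=e^{t\Psi(\theta)}$ for all $t\ge0$, $\theta\in\mathbb R^m$, where $$\Psi(\theta)=i\langle\mu,\theta\rangle-\tfrac12\theta\Sigma\theta'+\int\big(e^{i\langle\theta,x\rangle}-1-i\langle\theta,x\rangle\mathbf 1_{\mathbb D}(x)\big)\,\mathcal X(dx)$$ and $\mathbb D$ is the closed Euclidean unit ball centred at the origin (of $\mathbb R^m$, for whichever $m$ is relevant). An $n$-dimensional subordinator $T$ is a Lévy process in $\mathbb R^n$ with nondecreasing components; write $T\sim S^n(d,\mathcal T)$ if its triplet is $(d+\int_{\mathbb D}t\,\mathcal T(dt),0,\mathcal T)$, where $d\in[0,\infty)^n$ is its drift and $\mathcal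 T$ is a measure on $[0,\infty)^n_*:=[0,\infty)^n\setminus\{0\}$ with $\int_{\mathbb D}\|t\|\,\mathcal T(dt)<\infty$; $T$ is drift-less if $d=0$. For $\mathbf t\in[0,\infty)^n$ put $X(\mathbf t):=(X_1(t_1),\dots,X_n(t_n))$, so that $X(T(t))=(X_1(T_1(t)),\dots,X_n(T_n(t)))$. For $\mathbf t\in[0,\infty)^n$ with ordered components $t_{(1)}\le\dots\le t_{(n)}$, set $t_{(0)}:=0$, $\Delta t_{(k)}:=t_{(k)}-t_{(k-1)}$, and let $\pi_k$ be the coordinate projection $\mathbb R^n\to\mathbb R^n$ that keeps the coordinates $(k),\dots,(n)$ and sets the others to $0$. Put $\mathbf t\diamond\mu:=(t_k\mu_k)_k$, $(\mathbf t\diamond\Sigma)_{kl}:=\Sigma_{kl}\min(t_k,t_l)$, $$\mathbf t\diamond\mathcal X:=\sum_{k=1}^n\Delta t_{(k)}\,(\mathcal X\circ\pi_k^{-1})|_{\mathbb R^n\setminus\{0\}},\qquad c(\mathbf t,\mathcal X):=\sum_{k=2}^n\Delta t_{(k)}\int_{\mathbb D^C}\pi_k(x)\mathbf 1_{\mathbb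 D}(\pi_k(x))\,\mathcal X(dx).$$ Given $T\sim S^n(d,\mathcal T)$ and $X\sim L^n(\mu,\Sigma,\mathcal X)$, a process $Z=(Z_1,Z_2)$, possibly on another probability space, is *$T$ subordinating $X$ in the weak sense*, written $Z\stackrel d=(T,X\odot T)$, if $Z\sim L^{2n}(m,\Theta,\mathcal Z)$ with $m=(m_1,m_2)$, $$m_1=d+\int_{[0,\infty)^n_*}\mathbf t\,\mathbb P\big((\mathbf t,X(\mathbf t))\in\mathbb D\big)\,\mathcal T(d\mathbf t),$$ $$m_2=c(d,\mathcal X)+d\diamond\mu+\int_{[0,\infty)^n_*}\mathbb E\big[X(\mathbf t)\mathbf 1_{\mathbb D}(\mathbf t,X(\mathbf t))\big]\,\mathcal T(d\mathbf t),$$ $$\Theta=\begin{pmatrix}0&0\\0&d\diamond\Sigma\end{pmatrix},\qquad \mathcal Z(d\mathbf t,dx)=\big(\delta_0\otimes(d\diamond\mathcal X)\big)(d\mathbf t,dx)+\mathbf 1_{[0,\infty)^n_*\times\mathbb R^n}(\mathbf t,x)\,\mathbb P(X(\mathbf t)\in dx)\,\mathcal T(d\mathbf t).$$ One writes $Y\stackrel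 d=X\odot T$ if $Y$ has the same law as the component $Z_2$ of such a $Z$. **Proposition.** Let $T=(T_1,T_2)$, $X=(X_1,X_2)$ and $Y=(Y_1,Y_2)$ be bivariate Lévy processes, where $T$ and $X$ are independent (and defined on one probability space), $T$ is a subordinator, and the components $X_1,X_2$ of $X$ are dependent processes; $Y$ may live on another probability space. Then there is at least one $t\in(0,\infty)$ for which $X(T(t))\stackrel d=Y(t)$ fails, provided one of the following holds in addition: (i) $T(1)$ and $X(1)$ have finite second moments, $\operatorname{Cov}(X_1(1),X_2(1))\ne0$, and $T$ has non-monotonic components, that is, neither $T_2-T_1$ nor $T_1-T_2$ is a subordinator; (ii) $Y\stackrel d=X\odot T$, $X$ is symmetric (the processes $X$ and $-X$ have the same law), and $T_1,T_2$ are independent, drift-less and nontrivial (neither $T_1$ nor $T_2$ is a.s. the null process). -/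

import Mathlib

open MeasureTheory ProbabilityTheory Filter Topology
open scoped NNReal ENNReal

noncomputable section

namespace WeakSubordination

/-! ### Lévy processes and subordinators -/

section Processes

variable {Ω : Type*} [MeasurableSpace Ω] {ι : Type*} [Fintype ι]

/-- Right-continuous paths with left limits (at time `0` the condition on the left is void). -/
def IsCadlag (x : ℝ≥0 → EuclideanSpace ℝ ι) : Prop :=
  ∀ t, ContinuousWithinAt x (Set.Ici t) t ∧ ∃ l, Tendsto x (𝓝[<] t) (𝓝 l)

/-- `X` is a Lévy process with values in `ℝ^ι` under the probability measure `P`. -/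
structure IsLevyProcess (P : Measure Ω) (X : ℝ≥0 → Ω → EuclideanSpace ℝ ι) : Prop where
  measurable : ∀ t, Measurable (X t)
  zero : ∀ᵐ ω ∂P, X 0 ω = 0
  indepIncrements : HasIndepIncrements X P
  stationaryIncrements :
    ∀ s t : ℝ≥0, IdentDistrib (fun ω => X (s + t) ω - X s ω) (X t) P P
  cadlag : ∀ᵐ ω ∂P, IsCadlag (fun t => X t ω)

/-- A (multivariate) subordinator: a Lévy process with nondecreasing components. -/
structure IsSubordinator (P : Measure Ω) (T : ℝ≥0 → Ω → EuclideanSpace ℝ ι) : Prop where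
  levy : IsLevyProcess P T
  monotone : ∀ᵐ ω ∂P, ∀ k, Monotone (fun t => T t ω k)

/-- A process as a random element of the path space with the product `σ`-algebra; its law is the
collection of the finite dimensional distributions. -/
def path {E : Type*} (X : ℝ≥0 → Ω → E) : Ω → ℝ≥0 → E := fun ω t => X t ω

/-- The `k`-th component of a process. -/
def component (X : ℝ≥0 → Ω → EuclideanSpace ℝ ι) (k : ι) : ℝ≥0 → Ω → ℝ := fun t ω => X t ω k

/-- A real-valued process as a process with values in `ℝ¹`. -/
def scalar (X : ℝ≥0 → Ω → ℝ) : ℝ≥0 → Ω → EuclideanSpace ℝ (Fin 1) := fun t ω => !₂[X t ω]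

/-- A bivariate subordinator `(T₁, T₂)` has monotonic components if `T₂ - T₁` or `T₁ - T₂` is a
subordinator. -/
def HasMonotonicComponents (P : Measure Ω) (T : ℝ≥0 → Ω → EuclideanSpace ℝ (Fin 2)) : Prop :=
  IsSubordinator P (scalar fun t ω => T t ω 1 - T t ω 0) ∨
    IsSubordinator P (scalar fun t ω => T t ω 0 - T t ω 1)

/-- `X(𝐭) = (X_k(t_k))_k` for a multivariate time `𝐭 ∈ [0,∞)^ι`. -/
def multiTime (X : ℝ≥0 → Ω → EuclideanSpace ℝ ι) (t : EuclideanSpace ℝ ι) (ω : Ω) :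
    EuclideanSpace ℝ ι :=
  WithLp.toLp 2 fun k => X (t k).toNNReal ω k

/-- Strong subordination `(X ∘ T)(t) = (X_k(T_k(t)))_k`. -/
def strongSub (X T : ℝ≥0 → Ω → EuclideanSpace ℝ ι) : ℝ≥0 → Ω → EuclideanSpace ℝ ι :=
  fun t ω => multiTime X (T t ω) ω

end Processes

/-! ### Characteristic triplets -/

section Triplets

variable {Ω : Type*} [MeasurableSpace Ω] {ι : Type*} [Fintype ι]

/-- A Lévy measure: a Borel measure on `ℝ^ι ∖ {0}`, seen as a Borel measure on `ℝ^ι` without mass at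
the origin, that integrates `‖x‖² ∧ 1`. -/
def IsLevyMeasure (ν : Measure (EuclideanSpace ℝ ι)) : Prop :=
  ν {0} = 0 ∧ ∫⁻ x, ENNReal.ofReal (min (‖x‖ ^ 2) 1) ∂ν < ∞

/-- The Lévy exponent
`i⟨μ,θ⟩ - ½ θΣθ' + ∫ (e^{i⟨θ,x⟩} - 1 - i⟨θ,x⟩ 1_{‖x‖ ≤ 1}) ν(dx)`. -/
def levyExponent (μ : EuclideanSpace ℝ ι) (S : Matrix ι ι ℝ) (ν : Measure (EuclideanSpace ℝ ι))
    (θ : EuclideanSpace ℝ ι) : ℂ :=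
  Complex.I * (inner ℝ μ θ : ℝ) - 1 / 2 * ((∑ k, ∑ l, θ k * S k l * θ l : ℝ) : ℂ) +
    ∫ x, (Complex.exp (Complex.I * (inner ℝ θ x : ℝ)) - 1 -
      Complex.I * (if ‖x‖ ≤ 1 then (inner ℝ θ x : ℝ) else 0 : ℝ)) ∂ν

/-- `X ∼ L(μ, S, ν)`: `X` is a Lévy process with characteristic triplet `(μ, S, ν)`. -/
structure HasTriplet (P : Measure Ω) (X : ℝ≥0 → Ω → EuclideanSpace ℝ ι)
    (μ : EuclideanSpace ℝ ι) (S : Matrix ι ι ℝ) (ν : Measure (EuclideanSpace ℝ ι)) : Prop where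
  levy : IsLevyProcess P X
  covariance : S.PosSemidef
  levyMeasure : IsLevyMeasure ν
  charFun_eq : ∀ (t : ℝ≥0) (θ : EuclideanSpace ℝ ι),
    charFun (P.map (X t)) θ = Complex.exp (((t : ℝ) : ℂ) * levyExponent μ S ν θ)

/-- `[0,∞)^ι ∖ {0}`. -/
def orthant (ι : Type*) [Fintype ι] : Set (EuclideanSpace ℝ ι) :=
  {t | (∀ k, 0 ≤ t k) ∧ t ≠ 0}

/-- `T ∼ S(d, 𝒯)`: `T` is a subordinator with drift `d ∈ [0,∞)^ι` and Lévy measure `𝒯`, a measure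
on `[0,∞)^ι ∖ {0}` with `∫_{‖t‖ ≤ 1} ‖t‖ 𝒯(dt) < ∞`. The drift is `d = μ - ∫_{‖t‖ ≤ 1} t 𝒯(dt)`
for the characteristic triplet `(μ, 0, 𝒯)` of `T`. -/
structure HasDrift (P : Measure Ω) (T : ℝ≥0 → Ω → EuclideanSpace ℝ ι)
    (d : EuclideanSpace ℝ ι) (𝒯 : Measure (EuclideanSpace ℝ ι)) : Prop where
  subordinator : IsSubordinator P T
  drift_nonneg : ∀ k, 0 ≤ d k
  support : 𝒯 (orthant ι)ᶜ = 0
  finiteVariation : ∫⁻ t in Metric.closedBall 0 1, ENNReal.ofReal ‖t‖ ∂𝒯 < ∞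
  triplet : HasTriplet P T (d + ∫ t in Metric.closedBall 0 1, t ∂𝒯) 0 𝒯

/-- `T` is a drift-less subordinator. -/
def IsDriftless (P : Measure Ω) (T : ℝ≥0 → Ω → EuclideanSpace ℝ ι) : Prop :=
  ∃ 𝒯, HasDrift P T 0 𝒯

/-- A real-valued process is nontrivial if it is not the null process. -/
def IsNontrivial (P : Measure Ω) (X : ℝ≥0 → Ω → ℝ) : Prop :=
  ¬ ∀ᵐ ω ∂P, ∀ t, X t ω = 0

end Triplets

/-! ### The outer product with a multivariate time -/

section Outer

variable {n : ℕ}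

/-- The coordinate projection `x ↦ ∑_{j ∈ J} x_j e_j`. -/
def proj (J : Finset (Fin n)) (x : EuclideanSpace ℝ (Fin n)) : EuclideanSpace ℝ (Fin n) :=
  WithLp.toLp 2 fun j => if j ∈ J then x j else 0

/-- The image of `ν` under a coordinate projection, restricted to `ℝⁿ ∖ {0}`. -/
def projMeasure (J : Finset (Fin n)) (ν : Measure (EuclideanSpace ℝ (Fin n))) :
    Measure (EuclideanSpace ℝ (Fin n)) :=
  (ν.map (proj J)).restrict {0}ᶜ

/-- The spacing `Δt_(k) = t_(k) - t_(k-1)` of the ordered components `t_(1) ≤ … ≤ t_(n)`, where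
`t_(0) = 0`. Here `Tuple.sort t` is an ordering permutation, and indices are shifted by one, so
that `t_(k+1) = t (Tuple.sort t k)`. -/
def spacing (t : EuclideanSpace ℝ (Fin n)) (k : Fin n) : ℝ :=
  t (Tuple.sort (fun j => t j) k) -
    if (k : ℕ) = 0 then 0
    else t (Tuple.sort (fun j => t j) ⟨(k : ℕ) - 1, lt_of_le_of_lt (Nat.sub_le _ _) k.isLt⟩)

/-- The index set `{(k), …, (n)}`. -/
def upperIndices (t : EuclideanSpace ℝ (Fin n)) (k : Fin n) : Finset (Fin n) :=
  (Finset.Ici k).image (Tuple.sort (fun j => t j))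

/-- `t ⋄ μ = (t_k μ_k)_k`. -/
def outerVec (t μ : EuclideanSpace ℝ (Fin n)) : EuclideanSpace ℝ (Fin n) :=
  WithLp.toLp 2 fun k => t k * μ k

/-- `(t ⋄ S)_{kl} = S_{kl} (t_k ∧ t_l)`. -/
def outerMatrix (t : EuclideanSpace ℝ (Fin n)) (S : Matrix (Fin n) (Fin n) ℝ) :
    Matrix (Fin n) (Fin n) ℝ :=
  Matrix.of fun k l => S k l * min (t k) (t l)

/-- `t ⋄ ν = ∑_k Δt_(k) ν_{{(k), …, (n)}}`. -/
def outerMeasure (t : EuclideanSpace ℝ (Fin n)) (ν : Measure (EuclideanSpace ℝ (Fin n))) :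
    Measure (EuclideanSpace ℝ (Fin n)) :=
  ∑ k, ENNReal.ofReal (spacing t k) • projMeasure (upperIndices t k) ν

/-- The compensation term `c(t, ν)`, that is
`∑_{k ≥ 2} Δt_(k) ∫_{‖x‖ > 1} π_{{(k), …, (n)}}(x) 1_{‖π_{{(k), …, (n)}}(x)‖ ≤ 1} ν(dx)`. -/
def compensation (t : EuclideanSpace ℝ (Fin n)) (ν : Measure (EuclideanSpace ℝ (Fin n))) :
    EuclideanSpace ℝ (Fin n) :=
  ∑ k ∈ Finset.univ.filter (fun k : Fin n => 0 < (k : ℕ)), spacing t k •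
    ∫ x in {x | 1 < ‖x‖},
      {y : EuclideanSpace ℝ (Fin n) | ‖y‖ ≤ 1}.indicator id (proj (upperIndices t k) x) ∂ν

end Outer

/-! ### Weak subordination -/

section Weak

variable {Ω Ω' : Type*} [MeasurableSpace Ω] [MeasurableSpace Ω'] {n : ℕ}

/-- The pair `(t, x) ∈ ℝ^{2n}` of two vectors of `ℝⁿ`. -/
def pair (t x : EuclideanSpace ℝ (Fin n)) : EuclideanSpace ℝ (Fin n ⊕ Fin n) :=
  WithLp.toLp 2 (Sum.elim (fun k => t k) fun k => x k)

/-- The second component `Z₂` of an `ℝ^{2n}`-valued process `Z = (Z₁, Z₂)`. -/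
def second (Z : ℝ≥0 → Ω → EuclideanSpace ℝ (Fin n ⊕ Fin n)) :
    ℝ≥0 → Ω → EuclideanSpace ℝ (Fin n) :=
  fun t ω => WithLp.toLp 2 fun k => Z t ω (Sum.inr k)

/-- `m₁ = d + ∫ t ℙ(‖(t, X(t))‖ ≤ 1) 𝒯(dt)`. -/
def weakShift₁ (P : Measure Ω) (X : ℝ≥0 → Ω → EuclideanSpace ℝ (Fin n))
    (d : EuclideanSpace ℝ (Fin n)) (𝒯 : Measure (EuclideanSpace ℝ (Fin n))) :
    EuclideanSpace ℝ (Fin n) :=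
  d + ∫ t in orthant (Fin n), P.real {ω | ‖pair t (multiTime X t ω)‖ ≤ 1} • t ∂𝒯

/-- `m₂ = c(d, 𝒳) + d ⋄ μ + ∫ 𝔼[X(t) 1_{‖(t, X(t))‖ ≤ 1}] 𝒯(dt)`. -/
def weakShift₂ (P : Measure Ω) (X : ℝ≥0 → Ω → EuclideanSpace ℝ (Fin n))
    (d : EuclideanSpace ℝ (Fin n)) (𝒯 : Measure (EuclideanSpace ℝ (Fin n)))
    (μ : EuclideanSpace ℝ (Fin n)) (𝒳 : Measure (EuclideanSpace ℝ (Fin n))) :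
    EuclideanSpace ℝ (Fin n) :=
  compensation d 𝒳 + outerVec d μ +
    ∫ t in orthant (Fin n),
      (∫ ω, {ω | ‖pair t (multiTime X t ω)‖ ≤ 1}.indicator (multiTime X t) ω ∂P) ∂𝒯

/-- The Gaussian covariance matrix with blocks `0, 0, 0, d ⋄ S`. -/
def weakCov (d : EuclideanSpace ℝ (Fin n)) (S : Matrix (Fin n) (Fin n) ℝ) :
    Matrix (Fin n ⊕ Fin n) (Fin n ⊕ Fin n) ℝ :=
  Matrix.fromBlocks 0 0 0 (outerMatrix d S)

/-- The Lévy measure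
`(δ₀ ⊗ (d ⋄ 𝒳))(dt, dx) + 1_{[0,∞)ⁿ∖{0} × ℝⁿ}(t, x) ℙ(X(t) ∈ dx) 𝒯(dt)`; its second summand is the
image of `𝒯 ⊗ ℙ`, restricted to `t ∈ [0,∞)ⁿ∖{0}`, under `(t, ω) ↦ (t, X(t)(ω))`. -/
def weakLevyMeasure (P : Measure Ω) (X : ℝ≥0 → Ω → EuclideanSpace ℝ (Fin n))
    (d : EuclideanSpace ℝ (Fin n)) (𝒯 : Measure (EuclideanSpace ℝ (Fin n)))
    (𝒳 : Measure (EuclideanSpace ℝ (Fin n))) : Measure (EuclideanSpace ℝ (Fin n ⊕ Fin n)) :=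
  (outerMeasure d 𝒳).map (fun x => pair 0 x) +
    ((𝒯.restrict (orthant (Fin n))).prod P).map (fun p => pair p.1 (multiTime X p.1 p.2))

/-- `Z =ᵈ (T, X ⊙ T)`: the process `Z` (possibly on another probability space) is `T` subordinating
`X` in the weak sense. -/
def IsWeakSubordination (P : Measure Ω) (T X : ℝ≥0 → Ω → EuclideanSpace ℝ (Fin n))
    (R : Measure Ω') (Z : ℝ≥0 → Ω' → EuclideanSpace ℝ (Fin n ⊕ Fin n)) : Prop :=
  ∃ (d : EuclideanSpace ℝ (Fin n)) (𝒯 : Measure (EuclideanSpace ℝ (Fin n)))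
    (μ : EuclideanSpace ℝ (Fin n)) (S : Matrix (Fin n) (Fin n) ℝ)
    (𝒳 : Measure (EuclideanSpace ℝ (Fin n))),
    HasDrift P T d 𝒯 ∧ HasTriplet P X μ S 𝒳 ∧
      HasTriplet R Z (pair (weakShift₁ P X d 𝒯) (weakShift₂ P X d 𝒯 μ 𝒳)) (weakCov d S)
        (weakLevyMeasure P X d 𝒯 𝒳)

end Weak

end WeakSubordination

end

/-!
(i) Given `T`, the covariance of the two coordinates of `X (T t)` is `min (T₁ t) (T₂ t)` times that
of `X 1`, up to a correction from the means which is linear in `t`. If `X (T t)` had the law of a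
Lévy process for every `t`, then `E min (T₁ t) (T₂ t)` would be linear in `t`. But
`min (T₁, T₂)` is superadditive over consecutive time intervals, strictly so when the increments of
`T₁ - T₂` over them have strictly opposite signs; as these increments are independent, one of the
signs has probability zero, and `T` has monotonic components.

(ii) Since `T₁` and `T₂` are independent, the jumps of `T` lie on the coordinate axes, so the
exponent of the weakly subordinated process is additive and its coordinates are independent. The
exponent `g` of a symmetric `X` is real, and independence of the coordinates of `X (T t)` says that
`E exp (A + min (T₁ t) (T₂ t) * c) = E exp A`, where `c` measures the failure of `g` to be additive
in the two directions. As `min (T₁ t) (T₂ t)` is nonnegative and not almost surely zero for large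
`t`, `c = 0`; hence `X₁` and `X₂` would be independent.
-/

noncomputable section

namespace WeakSubordination

section RightContinuous

theorem tendsto_floor_mul_add_one_div (t : ℝ≥0) :
    Tendsto (fun n : ℕ => ((⌊((n : ℝ≥0) + 1) * t⌋₊ : ℝ≥0) + 1) / ((n : ℝ≥0) + 1)) atTop
      (𝓝[≥] t) := by
  have hlower (n : ℕ) : t ≤ ((⌊((n : ℝ≥0) + 1) * t⌋₊ : ℝ≥0) + 1) / ((n : ℝ≥0) + 1) := by
    rw [le_div_iff₀ (by positivity), mul_comm]
    exact (Nat.lt_floor_add_one _).le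
  have hupper (n : ℕ) :
      ((⌊((n : ℝ≥0) + 1) * t⌋₊ : ℝ≥0) + 1) / ((n : ℝ≥0) + 1) ≤ t + 1 / ((n : ℝ≥0) + 1) := by
    rw [div_le_iff₀ (by positivity), add_mul t, one_div, inv_mul_cancel₀ (by positivity),
      mul_comm t]
    gcongr
    exact Nat.floor_le (by positivity)
  have hlim : Tendsto (fun n : ℕ => t + 1 / ((n : ℝ≥0) + 1)) atTop (𝓝 t) := by
    simpa using tendsto_const_nhds.add (tendsto_one_div_add_atTop_nhds_zero_nat (𝕜 := ℝ≥0))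
  exact tendsto_nhdsWithin_iff.2
    ⟨tendsto_of_tendsto_of_tendsto_of_le_of_le tendsto_const_nhds hlim hlower hupper,
      Eventually.of_forall hlower⟩

theorem measurable_uncurry_of_rightContinuous {Ω E : Type*} [MeasurableSpace Ω]
    [TopologicalSpace E] [TopologicalSpace.PseudoMetrizableSpace E] [MeasurableSpace E]
    [BorelSpace E] {x : ℝ≥0 → Ω → E} (hm : ∀ t, Measurable (x t))
    (hc : ∀ ω t, ContinuousWithinAt (fun s => x s ω) (Set.Ici t) t) :
    Measurable (fun p : ℝ≥0 × Ω => x p.1 p.2) := by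
  refine measurable_of_tendsto_metrizable
    (f := fun (n : ℕ) (p : ℝ≥0 × Ω) => x ((⌊((n : ℝ≥0) + 1) * p.1⌋₊ + 1) / ((n : ℝ≥0) + 1)) p.2)
    (fun n => ?_)
    (tendsto_pi_nhds.2 fun p => (hc p.2 p.1).tendsto.comp (tendsto_floor_mul_add_one_div p.1))
  have hgrid : Measurable (fun q : ℕ × Ω => x ((q.1 + 1) / ((n : ℝ≥0) + 1)) q.2) :=
    measurable_from_prod_countable_right fun m => hm ((m + 1) / ((n : ℝ≥0) + 1))
  have hfloor : Measurable (fun p : ℝ≥0 × Ω => (⌊((n : ℝ≥0) + 1) * p.1⌋₊, p.2)) :=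
    Measurable.prodMk (Measurable.nat_floor (by fun_prop)) measurable_snd
  simpa only [Function.comp_def] using hgrid.comp hfloor

/-- The space of right-continuous paths with the `σ`-algebra generated by the evaluations. Unlike
on the full path space, evaluation is jointly measurable here, so that a process with such paths
can be evaluated at random times. -/
abbrev RightContinuousPath (E : Type*) [TopologicalSpace E] : Type _ :=
  {f : ℝ≥0 → E // ∀ t, ContinuousWithinAt f (Set.Ici t) t}

/-- The coordinate process on the space of right-continuous paths. -/
def coordProcess {E : Type*} [TopologicalSpace E] (t : ℝ≥0) (f : RightContinuousPath E) : E :=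
  f.1 t

theorem measurable_uncurry_coordProcess {E : Type*} [TopologicalSpace E]
    [TopologicalSpace.PseudoMetrizableSpace E] [MeasurableSpace E] [BorelSpace E] :
    Measurable (fun p : ℝ≥0 × RightContinuousPath E => coordProcess p.1 p.2) :=
  measurable_uncurry_of_rightContinuous
    (fun t => (measurable_pi_apply t).comp measurable_subtype_coe) fun f => f.2

variable {ι : Type*} [Finite ι]

theorem measurable_multiTime_coordProcess :
    Measurable (fun p : EuclideanSpace ℝ ι × RightContinuousPath (EuclideanSpace ℝ ι) =>
      multiTime coordProcess p.1 p.2) := by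
  refine (WithLp.measurable_toLp 2 _).comp (measurable_pi_lambda _ fun k => ?_)
  have htime : Measurable (fun p : EuclideanSpace ℝ ι × RightContinuousPath (EuclideanSpace ℝ ι) =>
      ((p.1 k).toNNReal, p.2)) := by fun_prop
  have heval := measurable_uncurry_coordProcess.comp htime
  fun_prop

end RightContinuous

section Modification

variable {Ω ι : Type*} {X : ℝ≥0 → Ω → EuclideanSpace ℝ ι}

theorem multiTime_eq_coordProcess {ω : Ω} {f : RightContinuousPath (EuclideanSpace ℝ ι)}
    (h : f.1 = path X ω) (t : EuclideanSpace ℝ ι) :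
    multiTime X t ω = multiTime coordProcess t f := by
  simp only [multiTime, coordProcess, h, path]

variable [MeasurableSpace Ω] {P : Measure Ω}

theorem IsLevyProcess.exists_rightContinuousPath (hX : IsLevyProcess P X) :
    ∃ ρ : Ω → RightContinuousPath (EuclideanSpace ℝ ι), Measurable ρ ∧
      ∀ᵐ ω ∂P, (ρ ω).1 = path X ω := by
  classical
  obtain ⟨S, hS, hcadlag⟩ := eventually_iff_exists_mem.1 hX.cadlag
  set N := toMeasurable P Sᶜ
  have hN : MeasurableSet N := measurableSet_toMeasurable P Sᶜ
  have hN0 : P N = 0 := by rw [measure_toMeasurable]; exact hS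
  refine ⟨fun ω => ⟨fun t => if ω ∈ N then 0 else X t ω, fun t => ?_⟩, ?_, ?_⟩
  · by_cases hω : ω ∈ N
    · simpa only [hω, if_true] using continuousWithinAt_const
    · have hωS : ω ∈ S := by
        by_contra hωS
        exact hω (subset_toMeasurable P Sᶜ hωS)
      simpa only [hω, if_false] using (hcadlag ω hωS t).1
  · exact Measurable.subtype_mk (measurable_pi_lambda _ fun t =>
      Measurable.ite hN measurable_const (hX.measurable t))
  · filter_upwards [measure_eq_zero_iff_ae_notMem.1 hN0] with ω hω
    funext t
    simp only [hω, if_false, path]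

variable [Finite ι]

theorem IsLevyProcess.aemeasurable_multiTime [SFinite P] (hX : IsLevyProcess P X)
    (ν : Measure (EuclideanSpace ℝ ι)) [SFinite ν] :
    AEMeasurable (fun p : EuclideanSpace ℝ ι × Ω => multiTime X p.1 p.2) (ν.prod P) := by
  obtain ⟨ρ, hρ, hρX⟩ := hX.exists_rightContinuousPath
  refine ⟨_, measurable_multiTime_coordProcess.comp (measurable_id.prodMap hρ), ?_⟩
  filter_upwards [Measure.quasiMeasurePreserving_snd.ae hρX] with p hp
  exact multiTime_eq_coordProcess hp p.1

theorem IsLevyProcess.aemeasurable_multiTime_comp (hX : IsLevyProcess P X)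
    {τ : Ω → EuclideanSpace ℝ ι} (hτ : Measurable τ) :
    AEMeasurable (fun ω => multiTime X (τ ω) ω) P := by
  obtain ⟨ρ, hρ, hρX⟩ := hX.exists_rightContinuousPath
  refine ⟨_, measurable_multiTime_coordProcess.comp (hτ.prodMk hρ), ?_⟩
  filter_upwards [hρX] with ω hω
  exact multiTime_eq_coordProcess hω _

theorem IsLevyProcess.map_multiTime_comp [IsProbabilityMeasure P] (hX : IsLevyProcess P X)
    {τ : Ω → EuclideanSpace ℝ ι} (hτ : Measurable τ) (hind : IndepFun τ (path X) P) :
    P.map (fun ω => multiTime X (τ ω) ω) =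
      ((P.map τ).prod P).map (fun p => multiTime X p.1 p.2) := by
  obtain ⟨ρ, hρ, hρX⟩ := hX.exists_rightContinuousPath
  have : IsProbabilityMeasure (P.map τ) := Measure.isProbabilityMeasure_map hτ.aemeasurable
  have hindρ : IndepFun τ ρ P := by
    have h : IndepFun τ (fun ω => (ρ ω).1) P :=
      hind.congr (EventuallyEq.refl _ _) (hρX.mono fun _ h => h.symm)
    rw [IndepFun_iff_Indep] at h ⊢
    convert h using 1
    exact MeasurableSpace.comap_comp
  calc P.map (fun ω => multiTime X (τ ω) ω)
      = P.map ((fun p => multiTime coordProcess p.1 p.2) ∘ fun ω => (τ ω, ρ ω)) :=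
        Measure.map_congr (hρX.mono fun ω hω => multiTime_eq_coordProcess hω _)
    _ = ((P.map τ).prod (P.map ρ)).map (fun p => multiTime coordProcess p.1 p.2) := by
        rw [← Measure.map_map measurable_multiTime_coordProcess (hτ.prodMk hρ),
          (indepFun_iff_map_prod_eq_prod_map_map hτ.aemeasurable hρ.aemeasurable).1 hindρ]
    _ = ((P.map τ).prod P).map
          ((fun p => multiTime coordProcess p.1 p.2) ∘ Prod.map id ρ) := by
        rw [← Measure.map_map measurable_multiTime_coordProcess (measurable_id.prodMap hρ),
          ← Measure.map_prod_map (P.map τ) P measurable_id hρ, Measure.map_id]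
    _ = ((P.map τ).prod P).map (fun p => multiTime X p.1 p.2) :=
        Measure.map_congr <| (Measure.quasiMeasurePreserving_snd.ae hρX).mono fun p hp =>
          (multiTime_eq_coordProcess hp p.1).symm

theorem IsLevyProcess.stronglyMeasurable_integral_comp [SFinite P] (hX : IsLevyProcess P X)
    {E : Type*} [NormedAddCommGroup E] [NormedSpace ℝ E] {f : EuclideanSpace ℝ ι → E}
    (hf : StronglyMeasurable f) : StronglyMeasurable (fun t => ∫ ω, f (X t ω) ∂P) := by
  obtain ⟨ρ, hρ, hρX⟩ := hX.exists_rightContinuousPath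
  have hjoint : StronglyMeasurable (fun q : ℝ≥0 × Ω => f (coordProcess q.1 (ρ q.2))) :=
    hf.comp_measurable (measurable_uncurry_coordProcess.comp
      (measurable_fst.prodMk (hρ.comp measurable_snd)))
  convert hjoint.integral_prod_right' (ν := P) using 2 with t
  refine integral_congr_ae ?_
  filter_upwards [hρX] with ω hω
  simp only [coordProcess, hω, path]

end Modification

section Additive

theorem eq_mul_of_measurable_of_add {f : ℝ≥0 → ℝ} (hf : Measurable f)
    (hadd : ∀ s t, f (s + t) = f s + f t) (t : ℝ≥0) : f t = t * f 1 := by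
  have hdecomp (x y : ℝ) : (x + y).toNNReal + (-x).toNNReal + (-y).toNNReal =
      (-(x + y)).toNNReal + x.toNNReal + y.toNNReal := by
    ext
    push_cast [Real.coe_toNNReal']
    linarith [max_zero_sub_max_neg_zero_eq_self x, max_zero_sub_max_neg_zero_eq_self y,
      max_zero_sub_max_neg_zero_eq_self (x + y)]
  let F : ℝ →+ ℝ :=
    { toFun := fun x => f x.toNNReal - f (-x).toNNReal
      map_zero' := by simp
      map_add' := fun x y => by
        have h := congrArg f (hdecomp x y)
        simp only [hadd] at h
        linarith }
  have hF : Measurable F := (hf.comp measurable_real_toNNReal).sub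
    (hf.comp (measurable_real_toNNReal.comp measurable_neg))
  have hFf (s : ℝ≥0) : F s = f s := by
    change f (s : ℝ).toNNReal - f (-(s : ℝ)).toNNReal = f s
    rw [Real.toNNReal_coe, Real.toNNReal_of_nonpos (by simp), sub_eq_self]
    simpa using hadd 0 0
  have hlin := map_real_smul F (Measure.AddMonoidHom.continuous_of_measurable F hF) (t : ℝ) 1
  have hF1 : F 1 = f 1 := hFf 1
  rwa [smul_eq_mul, mul_one, hFf, hF1, smul_eq_mul] at hlin

end Additive

section SquareIntegrable

variable {Ω E : Type*} [MeasurableSpace Ω] {P : Measure Ω} [IsProbabilityMeasure P]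
  [NormedAddCommGroup E] [SecondCountableTopology E] [MeasurableSpace E] [BorelSpace E]

theorem memLp_two_left_of_indepFun_of_memLp_add {U V : Ω → E} (hU : Measurable U)
    (hV : Measurable V) (hUV : IndepFun U V P) (h : MemLp (fun ω => U ω + V ω) 2 P) :
    MemLp U 2 P := by
  have : IsProbabilityMeasure (P.map U) := Measure.isProbabilityMeasure_map hU.aemeasurable
  have : IsProbabilityMeasure (P.map V) := Measure.isProbabilityMeasure_map hV.aemeasurable
  have hsum : MemLp (fun p : E × E => p.1 + p.2) 2 ((P.map U).prod (P.map V)) := by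
    rw [← (indepFun_iff_map_prod_eq_prod_map_map hU.aemeasurable hV.aemeasurable).1 hUV,
      memLp_map_measure_iff (by fun_prop) (by fun_prop)]
    exact h
  rw [memLp_two_iff_integrable_sq_norm (by fun_prop)] at hsum
  obtain ⟨v, hv⟩ := hsum.prod_left_ae.exists
  have hshift : MemLp (fun u : E => u + v) 2 (P.map U) :=
    (memLp_two_iff_integrable_sq_norm (by fun_prop)).2 hv
  have hid : MemLp (fun u : E => u) 2 (P.map U) := by
    simpa [Pi.sub_def] using hshift.sub (memLp_const v)
  exact (memLp_map_measure_iff (by fun_prop) hU.aemeasurable).1 hid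

end SquareIntegrable

theorem covariance_comp_eq_of_identDistrib {Ω Ω' E : Type*} [MeasurableSpace Ω]
    [MeasurableSpace Ω'] [MeasurableSpace E] {P : Measure Ω} {Q : Measure Ω'} {U : Ω → E}
    {V : Ω' → E} (h : IdentDistrib U V P Q) {f g : E → ℝ} (hf : Measurable f)
    (hg : Measurable g) :
    cov[fun ω => f (U ω), fun ω => g (U ω); P] = cov[fun ω => f (V ω), fun ω => g (V ω); Q] := by
  rw [← covariance_map_fun hf.aestronglyMeasurable hg.aestronglyMeasurable h.aemeasurable_fst,
    ← covariance_map_fun hf.aestronglyMeasurable hg.aestronglyMeasurable h.aemeasurable_snd,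
    h.map_eq]

section Moments

variable {Ω : Type*} [MeasurableSpace Ω] {P : Measure Ω} {ι : Type*}
  {X : ℝ≥0 → Ω → EuclideanSpace ℝ ι}

theorem IsLevyProcess.indepFun_increment (hX : IsLevyProcess P X) {s t : ℝ≥0} (hst : s ≤ t) :
    IndepFun (X s) (fun ω => X t ω - X s ω) P :=
  hX.indepIncrements.indepFun_eval_sub (zero_le (a := s)) hst hX.zero

theorem IsLevyProcess.identDistrib_increment (hX : IsLevyProcess P X) {s t : ℝ≥0} (hst : s ≤ t) :
    IdentDistrib (fun ω => X t ω - X s ω) (X (t - s)) P P := by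
  simpa [add_tsub_cancel_of_le hst] using hX.stationaryIncrements s (t - s)

variable [IsProbabilityMeasure P] [Fintype ι]

theorem IsLevyProcess.memLp_two (hX : IsLevyProcess P X) (h : MemLp (X 1) 2 P) (t : ℝ≥0) :
    MemLp (X t) 2 P := by
  have hnat (n : ℕ) : MemLp (X n) 2 P := by
    induction n with
    | zero =>
      refine (memLp_congr_ae ?_).2 (MemLp.zero (ε := EuclideanSpace ℝ ι))
      filter_upwards [hX.zero] with ω hω
      simpa using hω
    | succ n ih =>
      have hinc : MemLp (fun ω => X (n + 1) ω - X n ω) 2 P :=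
        (hX.stationaryIncrements n 1).memLp_iff.2 h
      simpa [Pi.add_def] using ih.add hinc
  obtain ⟨n, hn⟩ := exists_nat_ge t
  refine memLp_two_left_of_indepFun_of_memLp_add (hX.measurable t)
    ((hX.measurable n).sub (hX.measurable t)) (hX.indepFun_increment hn) ?_
  simpa using hnat n

theorem IsLevyProcess.memLp_two_eval (hX : IsLevyProcess P X) (h : MemLp (X 1) 2 P) (t : ℝ≥0)
    (k : ι) : MemLp (fun ω => X t ω k) 2 P :=
  memLp_piLp_iff.1 (hX.memLp_two h t) k

theorem IsLevyProcess.integral_eval (hX : IsLevyProcess P X) (h : MemLp (X 1) 2 P) (k : ι)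
    (t : ℝ≥0) : ∫ ω, X t ω k ∂P = t * ∫ ω, X 1 ω k ∂P := by
  have hk : Measurable fun x : EuclideanSpace ℝ ι => x k := by fun_prop
  have hint (t : ℝ≥0) : Integrable (fun ω => X t ω k) P :=
    (hX.memLp_two_eval h t k).integrable one_le_two
  refine eq_mul_of_measurable_of_add (f := fun t => ∫ ω, X t ω k ∂P)
    (hX.stronglyMeasurable_integral_comp hk.stronglyMeasurable).measurable (fun s t => ?_) t
  have hinc : ∫ ω, X (s + t) ω k - X s ω k ∂P = ∫ ω, X t ω k ∂P :=
    ((hX.stationaryIncrements s t).comp hk).integral_eq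
  rw [integral_sub (hint _) (hint _)] at hinc
  linarith

theorem IsLevyProcess.covariance_of_le (hX : IsLevyProcess P X) (h : MemLp (X 1) 2 P) {s t : ℝ≥0}
    (hst : s ≤ t) (i j : ι) :
    cov[fun ω => X s ω i, fun ω => X t ω j; P] = cov[fun ω => X s ω i, fun ω => X s ω j; P] := by
  have hs := hX.memLp_two_eval h s
  have ht := hX.memLp_two_eval h t
  have hinc : cov[fun ω => X s ω i, fun ω => X t ω j - X s ω j; P] = 0 :=
    ((hX.indepFun_increment hst).comp (φ := fun x : EuclideanSpace ℝ ι => x i)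
      (ψ := fun x : EuclideanSpace ℝ ι => x j) (by fun_prop) (by fun_prop)).covariance_eq_zero
        (hs i) ((ht j).sub (hs j))
  rwa [covariance_fun_sub_right (hs i) (ht j) (hs j), sub_eq_zero] at hinc

theorem IsLevyProcess.measurable_covariance (hX : IsLevyProcess P X) (h : MemLp (X 1) 2 P)
    (i j : ι) : Measurable fun t => cov[fun ω => X t ω i, fun ω => X t ω j; P] := by
  have hcov (t : ℝ≥0) : cov[fun ω => X t ω i, fun ω => X t ω j; P] =
      ∫ ω, X t ω i * X t ω j ∂P - (∫ ω, X t ω i ∂P) * ∫ ω, X t ω j ∂P :=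
    covariance_eq_sub (hX.memLp_two_eval h t i) (hX.memLp_two_eval h t j)
  have hmeas {f : EuclideanSpace ℝ ι → ℝ} (hf : Measurable f) :
      Measurable fun t => ∫ ω, f (X t ω) ∂P :=
    (hX.stronglyMeasurable_integral_comp hf.stronglyMeasurable).measurable
  simp only [hcov]
  exact (hmeas (f := fun x => x i * x j) (by fun_prop)).sub
    ((hmeas (f := fun x => x i) (by fun_prop)).mul (hmeas (f := fun x => x j) (by fun_prop)))

theorem IsLevyProcess.covariance_eval (hX : IsLevyProcess P X) (h : MemLp (X 1) 2 P) (i j : ι)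
    (t : ℝ≥0) : cov[fun ω => X t ω i, fun ω => X t ω j; P] =
      t * cov[fun ω => X 1 ω i, fun ω => X 1 ω j; P] := by
  have hL := hX.memLp_two_eval h
  refine eq_mul_of_measurable_of_add (f := fun t => cov[fun ω => X t ω i, fun ω => X t ω j; P])
    (hX.measurable_covariance h i j) (fun s t => ?_) t
  have hinc : cov[fun ω => X (s + t) ω i - X s ω i, fun ω => X (s + t) ω j - X s ω j; P] =
      cov[fun ω => X t ω i, fun ω => X t ω j; P] :=
    covariance_comp_eq_of_identDistrib (hX.stationaryIncrements s t)
      (f := fun x : EuclideanSpace ℝ ι => x i) (g := fun x : EuclideanSpace ℝ ι => x j)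
      (by fun_prop) (by fun_prop)
  rw [covariance_fun_sub_fun_sub (hL _ i) (hL _ i) (hL _ j) (hL _ j),
    covariance_comm (fun ω => X (s + t) ω i) (fun ω => X s ω j),
    hX.covariance_of_le h le_self_add, hX.covariance_of_le h le_self_add,
    covariance_comm (fun ω => X s ω j)] at hinc
  linarith

theorem IsLevyProcess.covariance_eval_eval (hX : IsLevyProcess P X) (h : MemLp (X 1) 2 P) (i j : ι)
    (s t : ℝ≥0) : cov[fun ω => X s ω i, fun ω => X t ω j; P] =
      min (s : ℝ) t * cov[fun ω => X 1 ω i, fun ω => X 1 ω j; P] := by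
  rcases le_total s t with hst | hst
  · rw [hX.covariance_of_le h hst, hX.covariance_eval h, min_eq_left (by exact_mod_cast hst)]
  · rw [covariance_comm, hX.covariance_of_le h hst, covariance_comm, hX.covariance_eval h,
      min_eq_right (by exact_mod_cast hst)]

theorem IsLevyProcess.integral_mul_eval (hX : IsLevyProcess P X) (h : MemLp (X 1) 2 P) (i j : ι)
    (s t : ℝ≥0) : ∫ ω, X s ω i * X t ω j ∂P =
      min (s : ℝ) t * cov[fun ω => X 1 ω i, fun ω => X 1 ω j; P] +
        (s * t) * ((∫ ω, X 1 ω i ∂P) * ∫ ω, X 1 ω j ∂P) := by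
  have hcov := covariance_eq_sub (hX.memLp_two_eval h s i) (hX.memLp_two_eval h t j)
  rw [hX.covariance_eval_eval h, hX.integral_eval h i s, hX.integral_eval h j t] at hcov
  simp only [Pi.mul_apply] at hcov
  linarith

end Moments

section Subordinators

variable {Ω : Type*} [MeasurableSpace Ω] {P : Measure Ω} {ι κ : Type*}

theorem IsSubordinator.ae_nonneg {T : ℝ≥0 → Ω → EuclideanSpace ℝ ι} (hT : IsSubordinator P T) :
    ∀ᵐ ω ∂P, ∀ t k, 0 ≤ T t ω k := by
  filter_upwards [hT.levy.zero, hT.monotone] with ω hzero hmono t k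
  simpa [hzero] using hmono k (zero_le (a := t))

theorem IsSubordinator.ae_map_nonneg [Finite ι] {T : ℝ≥0 → Ω → EuclideanSpace ℝ ι}
    (hT : IsSubordinator P T) (t : ℝ≥0) :
    ∀ᵐ τ ∂(P.map (T t)), ∀ k, 0 ≤ τ k := by
  rw [ae_map_iff (hT.levy.measurable t).aemeasurable]
  · filter_upwards [hT.ae_nonneg] with ω h using h t
  · simp only [Set.ofPred_forall]
    exact MeasurableSet.iInter fun k => measurableSet_le measurable_const (by fun_prop)

theorem indepFun_eval_path {E F : Type*} [MeasurableSpace E] [MeasurableSpace F]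
    {T : ℝ≥0 → Ω → E} {X : ℝ≥0 → Ω → F} (hTX : IndepFun (path T) (path X) P) (t : ℝ≥0) :
    IndepFun (T t) (path X) P :=
  hTX.comp (φ := fun f : ℝ≥0 → E => f t) (ψ := id) (measurable_pi_apply (X := fun _ => E) t)
    measurable_id

theorem IsLevyProcess.map [Finite ι] [Finite κ] {X : ℝ≥0 → Ω → EuclideanSpace ℝ ι}
    (hX : IsLevyProcess P X) (L : EuclideanSpace ℝ ι →L[ℝ] EuclideanSpace ℝ κ) :
    IsLevyProcess P (fun t ω => L (X t ω)) where
  measurable t := L.continuous.measurable.comp (hX.measurable t)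
  zero := by filter_upwards [hX.zero] with ω hω; rw [hω, map_zero]
  indepIncrements := hX.indepIncrements.map' L.continuous.measurable
  stationaryIncrements s t := by
    simpa [Function.comp_def] using (hX.stationaryIncrements s t).comp L.continuous.measurable
  cadlag := by
    filter_upwards [hX.cadlag] with ω hω t
    obtain ⟨hright, l, hl⟩ := hω t
    exact ⟨L.continuous.continuousAt.comp_continuousWithinAt hright, L l,
      (L.continuous.tendsto l).comp hl⟩

theorem IsLevyProcess.scalar_sub [Finite ι] {T : ℝ≥0 → Ω → EuclideanSpace ℝ ι}
    (hT : IsLevyProcess P T) (i j : ι) :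
    IsLevyProcess P (scalar fun t ω => T t ω i - T t ω j) := by
  let L : EuclideanSpace ℝ ι →L[ℝ] EuclideanSpace ℝ (Fin 1) :=
    (ContinuousLinearMap.toSpanSingleton ℝ (!₂[(1 : ℝ)] : EuclideanSpace ℝ (Fin 1))).comp
      (EuclideanSpace.proj i - EuclideanSpace.proj j)
  convert hT.map L using 3 with t ω
  ext k
  fin_cases k
  simp [L, scalar]

theorem frequently_rat_nhdsGT {t u : ℝ≥0} (htu : t < u) :
    ∃ᶠ r in 𝓝[>] t, t < r ∧ r < u ∧ ∃ q : ℚ, (q : ℝ).toNNReal = r := by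
  rw [frequently_iff]
  intro U hU
  obtain ⟨v, hv, hvU⟩ := (mem_nhdsGT_iff_exists_Ioo_subset' htu).1 hU
  obtain ⟨q, -, htq, hq⟩ := (NNReal.lt_iff_exists_rat_btwn t (min v u)).1 (lt_min hv htu)
  exact ⟨_, hvU ⟨htq, hq.trans_le (min_le_left _ _)⟩, htq, hq.trans_le (min_le_right _ _), q, rfl⟩

theorem monotone_of_rightContinuous_of_monotone_rat {E : Type*} [TopologicalSpace E] [Preorder E]
    [OrderClosedTopology E] {f : ℝ≥0 → E} (hc : ∀ t, ContinuousWithinAt f (Set.Ici t) t)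
    (hq : Monotone fun q : ℚ => f (q : ℝ).toNNReal) : Monotone f := by
  have hlim (t : ℝ≥0) : Tendsto f (𝓝[>] t) (𝓝 (f t)) :=
    (hc t).tendsto.mono_left (nhdsWithin_mono _ Set.Ioi_subset_Ici_self)
  have hrat (s : ℝ≥0) (q : ℚ) (hs : s < (q : ℝ).toNNReal) : f s ≤ f (q : ℝ).toNNReal := by
    refine le_of_tendsto_of_frequently (hlim s) ((frequently_rat_nhdsGT hs).mono ?_)
    rintro _ ⟨-, hpq, p, rfl⟩
    exact hq (Rat.cast_le.1 (Real.toNNReal_lt_toNNReal_iff'.1 hpq).1.le)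
  intro s t hst
  refine ge_of_tendsto_of_frequently (hlim t) ((frequently_rat_nhdsGT (lt_add_one t)).mono ?_)
  rintro _ ⟨htq, -, q, rfl⟩
  exact hrat s q (hst.trans_lt htq)

theorem isSubordinator_scalar_of_nonneg {D : ℝ≥0 → Ω → ℝ} (hD : IsLevyProcess P (scalar D))
    (h : ∀ t, ∀ᵐ ω ∂P, 0 ≤ D t ω) : IsSubordinator P (scalar D) := by
  have hinc {s t : ℝ≥0} (hst : s ≤ t) : ∀ᵐ ω ∂P, D s ω ≤ D t ω := by
    have hnonneg := (hD.identDistrib_increment hst).symm.ae_snd (p := fun x => 0 ≤ x 0)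
      (measurableSet_le measurable_const (by fun_prop)) (by simpa [scalar] using h (t - s))
    filter_upwards [hnonneg] with ω hω
    simpa [scalar] using hω
  have hrat : ∀ᵐ ω ∂P, ∀ p q : ℚ, p ≤ q → D (p : ℝ).toNNReal ω ≤ D (q : ℝ).toNNReal ω := by
    simp only [ae_all_iff]
    exact fun p q hpq => hinc (Real.toNNReal_le_toNNReal (Rat.cast_le.2 hpq))
  refine ⟨hD, ?_⟩
  filter_upwards [hrat, hD.cadlag] with ω hmono hcadlag k
  fin_cases k
  exact monotone_of_rightContinuous_of_monotone_rat (fun t =>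
    (EuclideanSpace.proj (𝕜 := ℝ) (0 : Fin 1)).continuous.continuousAt.comp_continuousWithinAt
      (hcadlag t).1) fun p q => hmono p q

end Subordinators

section StrongCovariance

variable {Ω : Type*} [MeasurableSpace Ω] {P : Measure Ω} [IsProbabilityMeasure P]
  {ι : Type*} {T X : ℝ≥0 → Ω → EuclideanSpace ℝ ι}

theorem IsLevyProcess.identDistrib_strongSub [Finite ι] (hX : IsLevyProcess P X)
    (hTX : IndepFun (path T) (path X) P) {t : ℝ≥0} (hT : Measurable (T t)) :
    IdentDistrib (fun p : EuclideanSpace ℝ ι × Ω => multiTime X p.1 p.2) (strongSub X T t)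
      ((P.map (T t)).prod P) P := by
  have : IsProbabilityMeasure (P.map (T t)) := Measure.isProbabilityMeasure_map hT.aemeasurable
  exact ⟨hX.aemeasurable_multiTime _, hX.aemeasurable_multiTime_comp hT,
    (hX.map_multiTime_comp hT (indepFun_eval_path hTX t)).symm⟩

variable [Fintype ι]

theorem IsLevyProcess.integral_multiTime (hX : IsLevyProcess P X) (hX1 : MemLp (X 1) 2 P)
    {τ : EuclideanSpace ℝ ι} {k : ι} (hk : 0 ≤ τ k) :
    ∫ ω, multiTime X τ ω k ∂P = τ k * ∫ ω, X 1 ω k ∂P :=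
  (hX.integral_eval hX1 k (τ k).toNNReal).trans (by rw [Real.coe_toNNReal _ hk])

theorem IsLevyProcess.integral_multiTime_mul (hX : IsLevyProcess P X) (hX1 : MemLp (X 1) 2 P)
    {τ : EuclideanSpace ℝ ι} {i j : ι} (hi : 0 ≤ τ i) (hj : 0 ≤ τ j) :
    ∫ ω, multiTime X τ ω i * multiTime X τ ω j ∂P =
      min (τ i) (τ j) * cov[fun ω => X 1 ω i, fun ω => X 1 ω j; P] +
        (τ i * τ j) * ((∫ ω, X 1 ω i ∂P) * ∫ ω, X 1 ω j ∂P) :=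
  (hX.integral_mul_eval hX1 i j (τ i).toNNReal (τ j).toNNReal).trans
    (by rw [Real.coe_toNNReal _ hi, Real.coe_toNNReal _ hj])

section Mixture

variable {ν : Measure (EuclideanSpace ℝ ι)}

theorem IsLevyProcess.memLp_multiTime [IsFiniteMeasure ν] (hX : IsLevyProcess P X)
    (hX1 : MemLp (X 1) 2 P) (hν : MemLp id 2 ν) (hpos : ∀ᵐ τ ∂ν, ∀ k, 0 ≤ τ k) (k : ι) :
    MemLp (fun p : EuclideanSpace ℝ ι × Ω => multiTime X p.1 p.2 k) 2 (ν.prod P) := by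
  have hmeas : AEStronglyMeasurable (fun p : EuclideanSpace ℝ ι × Ω => multiTime X p.1 p.2 k)
      (ν.prod P) := ((EuclideanSpace.proj (𝕜 := ℝ) k).continuous.measurable.comp_aemeasurable
    (hX.aemeasurable_multiTime ν)).aestronglyMeasurable
  have hk : MemLp (fun τ : EuclideanSpace ℝ ι => τ k) 2 ν := memLp_piLp_iff.1 hν k
  have hsq : AEStronglyMeasurable (fun p : EuclideanSpace ℝ ι × Ω => multiTime X p.1 p.2 k ^ 2)
      (ν.prod P) := hmeas.pow 2
  rw [memLp_two_iff_integrable_sq hmeas, integrable_prod_iff hsq]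
  refine ⟨ae_of_all _ fun τ => (hX.memLp_two_eval hX1 (τ k).toNNReal k).integrable_sq, ?_⟩
  have hsecond : Integrable (fun τ : EuclideanSpace ℝ ι =>
      τ k * cov[fun ω => X 1 ω k, fun ω => X 1 ω k; P] +
        τ k ^ 2 * ((∫ ω, X 1 ω k ∂P) * ∫ ω, X 1 ω k ∂P)) ν :=
    ((hk.integrable one_le_two).mul_const _).add (hk.integrable_sq.mul_const _)
  refine hsecond.congr ?_
  filter_upwards [hpos] with τ hτ
  have h := hX.integral_multiTime_mul hX1 (hτ k) (hτ k)
  rw [min_self, ← pow_two] at h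
  simp only [Real.norm_eq_abs, abs_pow, sq_abs]
  rw [← h]
  simp only [pow_two]

variable [IsProbabilityMeasure ν]

theorem IsLevyProcess.integral_prod_multiTime (hX : IsLevyProcess P X) (hX1 : MemLp (X 1) 2 P)
    (hν : MemLp id 2 ν) (hpos : ∀ᵐ τ ∂ν, ∀ k, 0 ≤ τ k) (k : ι) :
    ∫ p : EuclideanSpace ℝ ι × Ω, multiTime X p.1 p.2 k ∂(ν.prod P) =
      (∫ τ, τ k ∂ν) * ∫ ω, X 1 ω k ∂P := by
  rw [integral_prod _ ((hX.memLp_multiTime hX1 hν hpos k).integrable one_le_two),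
    ← integral_mul_const]
  exact integral_congr_ae (hpos.mono fun τ hτ => hX.integral_multiTime hX1 (hτ k))

theorem IsLevyProcess.integral_prod_multiTime_mul (hX : IsLevyProcess P X)
    (hX1 : MemLp (X 1) 2 P) (hν : MemLp id 2 ν) (hpos : ∀ᵐ τ ∂ν, ∀ k, 0 ≤ τ k) (i j : ι) :
    ∫ p : EuclideanSpace ℝ ι × Ω, multiTime X p.1 p.2 i * multiTime X p.1 p.2 j ∂(ν.prod P) =
      (∫ τ, min (τ i) (τ j) ∂ν) * cov[fun ω => X 1 ω i, fun ω => X 1 ω j; P] +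
        (∫ τ, τ i * τ j ∂ν) * ((∫ ω, X 1 ω i ∂P) * ∫ ω, X 1 ω j ∂P) := by
  have hk (k : ι) : MemLp (fun τ : EuclideanSpace ℝ ι => τ k) 2 ν := memLp_piLp_iff.1 hν k
  have hmul : Integrable (fun p : EuclideanSpace ℝ ι × Ω =>
      multiTime X p.1 p.2 i * multiTime X p.1 p.2 j) (ν.prod P) :=
    (hX.memLp_multiTime hX1 hν hpos i).integrable_mul (hX.memLp_multiTime hX1 hν hpos j)
  rw [integral_prod _ hmul, ← integral_mul_const, ← integral_mul_const, ← integral_add]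
  · exact integral_congr_ae (hpos.mono fun τ hτ => hX.integral_multiTime_mul hX1 (hτ i) (hτ j))
  · exact (((hk i).integrable one_le_two).inf ((hk j).integrable one_le_two)).mul_const _
  · exact ((hk i).integrable_mul (hk j)).mul_const _

theorem IsLevyProcess.covariance_multiTime (hX : IsLevyProcess P X) (hX1 : MemLp (X 1) 2 P)
    (hν : MemLp id 2 ν) (hpos : ∀ᵐ τ ∂ν, ∀ k, 0 ≤ τ k) (i j : ι) :
    cov[fun p : EuclideanSpace ℝ ι × Ω => multiTime X p.1 p.2 i,
        fun p => multiTime X p.1 p.2 j; ν.prod P] =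
      (∫ τ, min (τ i) (τ j) ∂ν) * cov[fun ω => X 1 ω i, fun ω => X 1 ω j; P] +
        cov[fun τ => τ i, fun τ => τ j; ν] * ((∫ ω, X 1 ω i ∂P) * ∫ ω, X 1 ω j ∂P) := by
  have hk (k : ι) : MemLp (fun τ : EuclideanSpace ℝ ι => τ k) 2 ν := memLp_piLp_iff.1 hν k
  have hF := hX.memLp_multiTime hX1 hν hpos
  rw [covariance_eq_sub (hF i) (hF j), covariance_eq_sub (hk i) (hk j)]
  simp only [Pi.mul_apply]
  rw [hX.integral_prod_multiTime hX1 hν hpos, hX.integral_prod_multiTime hX1 hν hpos,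
    hX.integral_prod_multiTime_mul hX1 hν hpos]
  ring

end Mixture

theorem memLp_map_id (hT : IsLevyProcess P T) (hT1 : MemLp (T 1) 2 P) (t : ℝ≥0) :
    MemLp id 2 (P.map (T t)) :=
  (memLp_map_measure_iff (by fun_prop) (hT.measurable t).aemeasurable).2 (hT.memLp_two hT1 t)

theorem covariance_strongSub (hT : IsSubordinator P T) (hX : IsLevyProcess P X)
    (hTX : IndepFun (path T) (path X) P) (hT1 : MemLp (T 1) 2 P) (hX1 : MemLp (X 1) 2 P)
    (i j : ι) (t : ℝ≥0) :
    cov[fun ω => strongSub X T t ω i, fun ω => strongSub X T t ω j; P] =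
      (∫ ω, min (T t ω i) (T t ω j) ∂P) * cov[fun ω => X 1 ω i, fun ω => X 1 ω j; P] +
        t * cov[fun ω => T 1 ω i, fun ω => T 1 ω j; P] *
          ((∫ ω, X 1 ω i ∂P) * ∫ ω, X 1 ω j ∂P) := by
  have hTt := (hT.levy.measurable t).aemeasurable (μ := P)
  have : IsProbabilityMeasure (P.map (T t)) := Measure.isProbabilityMeasure_map hTt
  rw [← covariance_comp_eq_of_identDistrib
      (hX.identDistrib_strongSub hTX (hT.levy.measurable t))
      (f := fun x : EuclideanSpace ℝ ι => x i) (g := fun x : EuclideanSpace ℝ ι => x j)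
      (by fun_prop) (by fun_prop),
    hX.covariance_multiTime hX1 (memLp_map_id hT.levy hT1 t) (hT.ae_map_nonneg t),
    integral_map hTt (by fun_prop), covariance_map_fun (by fun_prop) (by fun_prop) hTt,
    hT.levy.covariance_eval hT1]

theorem memLp_strongSub (hT : IsSubordinator P T) (hX : IsLevyProcess P X)
    (hTX : IndepFun (path T) (path X) P) (hT1 : MemLp (T 1) 2 P) (hX1 : MemLp (X 1) 2 P)
    (t : ℝ≥0) : MemLp (strongSub X T t) 2 P := by
  have hTt := hT.levy.measurable t
  have : IsProbabilityMeasure (P.map (T t)) := Measure.isProbabilityMeasure_map hTt.aemeasurable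
  rw [← (hX.identDistrib_strongSub hTX hTt).memLp_iff, memLp_piLp_iff]
  exact hX.memLp_multiTime hX1 (memLp_map_id hT.levy hT1 t) (hT.ae_map_nonneg t)

end StrongCovariance

section MonotonicComponents

theorem min_add_min_lt_min_add_add {a b c d : ℝ} (hab : a < b) (hdc : d < c) :
    min a b + min c d < min (a + c) (b + d) := by
  rw [min_eq_left hab.le, min_eq_right hdc.le]
  exact lt_min (by gcongr) (by gcongr)

variable {Ω : Type*} [MeasurableSpace Ω] {P : Measure Ω} [IsProbabilityMeasure P]

section Components

variable {ι : Type*} [Fintype ι] {T : ℝ≥0 → Ω → EuclideanSpace ℝ ι} {i j : ι} {s t : ℝ≥0}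

theorem IsLevyProcess.ae_min_add_min_eq (hT : IsLevyProcess P T) (hT1 : MemLp (T 1) 2 P)
    (hadd : ∫ ω, min (T (s + t) ω i) (T (s + t) ω j) ∂P =
      ∫ ω, min (T s ω i) (T s ω j) ∂P + ∫ ω, min (T t ω i) (T t ω j) ∂P) :
    ∀ᵐ ω ∂P, min (T s ω i) (T s ω j) +
        min (T (s + t) ω i - T s ω i) (T (s + t) ω j - T s ω j) =
      min (T (s + t) ω i) (T (s + t) ω j) := by
  have hint (u : ℝ≥0) (k : ι) : Integrable (fun ω => T u ω k) P :=
    (hT.memLp_two_eval hT1 u k).integrable one_le_two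
  have hmin (u : ℝ≥0) : Integrable (fun ω => min (T u ω i) (T u ω j)) P :=
    (hint u i).inf (hint u j)
  have hmin_inc :
      Integrable (fun ω => min (T (s + t) ω i - T s ω i) (T (s + t) ω j - T s ω j)) P :=
    ((hint _ i).sub (hint _ i)).inf ((hint _ j).sub (hint _ j))
  have hinc : ∫ ω, min (T (s + t) ω i - T s ω i) (T (s + t) ω j - T s ω j) ∂P =
      ∫ ω, min (T t ω i) (T t ω j) ∂P :=
    ((hT.stationaryIncrements s t).comp
      (u := fun x : EuclideanSpace ℝ ι => min (x i) (x j)) (by fun_prop)).integral_eq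
  refine (integral_eq_iff_of_ae_le ((hmin s).add hmin_inc) (hmin (s + t))
    (ae_of_all _ fun ω => ?_)).1 ?_
  · simpa using min_add_min_le_min_add_add (a := T s ω i)
      (b := T (s + t) ω i - T s ω i) (c := T s ω j) (d := T (s + t) ω j - T s ω j)
  · rw [hadd, ← hinc]
    exact integral_add (hmin s) hmin_inc

theorem IsLevyProcess.measure_lt_mul_measure_gt_eq_zero (hT : IsLevyProcess P T)
    (hT1 : MemLp (T 1) 2 P) (hadd : ∫ ω, min (T (s + t) ω i) (T (s + t) ω j) ∂P =
      ∫ ω, min (T s ω i) (T s ω j) ∂P + ∫ ω, min (T t ω i) (T t ω j) ∂P) :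
    P {ω | T s ω i < T s ω j} * P {ω | T t ω j < T t ω i} = 0 := by
  have hlt (k l : ι) : MeasurableSet {x : EuclideanSpace ℝ ι | x k < x l} :=
    measurableSet_lt (by fun_prop) (by fun_prop)
  have hindep := (hT.indepFun_increment (le_self_add : s ≤ s + t)).measure_inter_preimage_eq_mul
    _ _ (hlt i j) (hlt j i)
  have hstat : P ((fun ω => T (s + t) ω - T s ω) ⁻¹' {x | x j < x i}) =
      P {ω | T t ω j < T t ω i} :=
    (hT.stationaryIncrements s t).measure_mem_eq (hlt j i)
  rw [hstat, Set.preimage_ofPred_eq] at hindep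
  rw [← hindep]
  refine measure_mono_null ?_ (ae_iff.1 (hT.ae_min_add_min_eq hT1 hadd))
  intro ω ⟨hs, hinc⟩
  simpa using (min_add_min_lt_min_add_add hs hinc).ne

end Components

theorem hasMonotonicComponents_of_integral_min_add {T : ℝ≥0 → Ω → EuclideanSpace ℝ (Fin 2)}
    (hT : IsLevyProcess P T) (hT1 : MemLp (T 1) 2 P)
    (hadd : ∀ s t : ℝ≥0, ∫ ω, min (T (s + t) ω 0) (T (s + t) ω 1) ∂P =
      ∫ ω, min (T s ω 0) (T s ω 1) ∂P + ∫ ω, min (T t ω 0) (T t ω 1) ∂P) :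
    HasMonotonicComponents P T := by
  have hle {i j : Fin 2} {t : ℝ≥0} (h : P {ω | T t ω j < T t ω i} = 0) :
      ∀ᵐ ω ∂P, 0 ≤ T t ω j - T t ω i := by
    filter_upwards [measure_eq_zero_iff_ae_notMem.1 h] with ω hω
    exact sub_nonneg.2 (not_lt.1 hω)
  by_cases h : ∀ s, P {ω | T s ω 0 < T s ω 1} = 0
  · exact Or.inr (isSubordinator_scalar_of_nonneg (hT.scalar_sub 0 1) fun s => hle (h s))
  · obtain ⟨s, hs⟩ := not_forall.1 h
    exact Or.inl (isSubordinator_scalar_of_nonneg (hT.scalar_sub 1 0) fun t => hle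
      ((mul_eq_zero.1 (hT.measure_lt_mul_measure_gt_eq_zero hT1 (hadd s t))).resolve_left hs))

section StrongSubordination

variable {ι Ω' : Type*} [Fintype ι] [MeasurableSpace Ω'] {Q : Measure Ω'} [IsProbabilityMeasure Q]
  {T X : ℝ≥0 → Ω → EuclideanSpace ℝ ι} {Y : ℝ≥0 → Ω' → EuclideanSpace ℝ ι}

theorem exists_integral_min_eq_mul_of_identDistrib (hT : IsSubordinator P T)
    (hX : IsLevyProcess P X) (hY : IsLevyProcess Q Y) (hTX : IndepFun (path T) (path X) P)
    (hT1 : MemLp (T 1) 2 P) (hX1 : MemLp (X 1) 2 P) {i j : ι}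
    (hcov : cov[fun ω => X 1 ω i, fun ω => X 1 ω j; P] ≠ 0)
    (hid : ∀ t : ℝ≥0, 0 < t → IdentDistrib (strongSub X T t) (Y t) P Q) :
    ∃ c : ℝ, ∀ t : ℝ≥0, ∫ ω, min (T t ω i) (T t ω j) ∂P = t * c := by
  have hY1 : MemLp (Y 1) 2 Q :=
    (hid 1 one_pos).memLp_iff.1 (memLp_strongSub hT hX hTX hT1 hX1 1)
  refine ⟨(cov[fun ω => Y 1 ω i, fun ω => Y 1 ω j; Q] -
    cov[fun ω => T 1 ω i, fun ω => T 1 ω j; P] * ((∫ ω, X 1 ω i ∂P) * ∫ ω, X 1 ω j ∂P)) /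
      cov[fun ω => X 1 ω i, fun ω => X 1 ω j; P], fun t => ?_⟩
  rcases eq_or_lt_of_le (zero_le (a := t)) with rfl | ht
  · have hzero : (fun ω => min (T 0 ω i) (T 0 ω j)) =ᵐ[P] fun _ => 0 := by
      filter_upwards [hT.levy.zero] with ω hω
      simp [hω]
    simp [integral_congr_ae hzero]
  · have h := covariance_strongSub hT hX hTX hT1 hX1 i j t
    rw [covariance_comp_eq_of_identDistrib (hid t ht) (f := fun x : EuclideanSpace ℝ ι => x i)
      (g := fun x : EuclideanSpace ℝ ι => x j) (by fun_prop) (by fun_prop),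
      hY.covariance_eval hY1] at h
    field_simp
    linarith

end StrongSubordination

theorem hasMonotonicComponents_of_identDistrib {Ω' : Type*} [MeasurableSpace Ω'] {Q : Measure Ω'}
    [IsProbabilityMeasure Q] {T X : ℝ≥0 → Ω → EuclideanSpace ℝ (Fin 2)}
    {Y : ℝ≥0 → Ω' → EuclideanSpace ℝ (Fin 2)} (hT : IsSubordinator P T) (hX : IsLevyProcess P X)
    (hY : IsLevyProcess Q Y) (hTX : IndepFun (path T) (path X) P) (hT1 : MemLp (T 1) 2 P)
    (hX1 : MemLp (X 1) 2 P) (hcov : cov[fun ω => X 1 ω 0, fun ω => X 1 ω 1; P] ≠ 0)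
    (hid : ∀ t : ℝ≥0, 0 < t → IdentDistrib (strongSub X T t) (Y t) P Q) :
    HasMonotonicComponents P T := by
  obtain ⟨c, hc⟩ := exists_integral_min_eq_mul_of_identDistrib hT hX hY hTX hT1 hX1 hcov hid
  refine hasMonotonicComponents_of_integral_min_add hT.levy hT1 fun s t => ?_
  rw [hc, hc, hc, NNReal.coe_add, add_mul]

end MonotonicComponents

section CharExponent

open EuclideanSpace (single)

theorem eq_of_forall_exp_mul_eq {a b : ℂ}
    (h : ∀ t : ℝ≥0, Complex.exp ((t : ℝ) * a) = Complex.exp ((t : ℝ) * b)) : a = b := by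
  have hderiv (c : ℂ) :
      HasDerivWithinAt (fun t : ℝ => Complex.exp (t * c)) c (Set.Ici 0) 0 := by
    simpa using ((Complex.ofRealCLM.hasDerivAt (x := 0)).mul_const c).cexp.hasDerivWithinAt
  exact (uniqueDiffOn_Ici 0 0 Set.self_mem_Ici).eq_deriv _ (hderiv a)
    ((hderiv b).congr (fun t ht => h ⟨t, ht⟩) (h 0))

variable {Ω : Type*} [MeasurableSpace Ω] {P : Measure Ω}
  {E : Type*} [NormedAddCommGroup E] [InnerProductSpace ℝ E] [MeasurableSpace E]
  {X : ℝ≥0 → Ω → E} {φ ψ : E → ℂ} {g : E → ℝ}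

/-- `ψ` is the characteristic exponent of the process `X`, that is
`𝔼 e^{i⟨X(t),θ⟩} = e^{t ψ(θ)}`. -/
def HasCharExponent (P : Measure Ω) (X : ℝ≥0 → Ω → E) (ψ : E → ℂ) : Prop :=
  ∀ (t : ℝ≥0) (θ : E), charFun (P.map (X t)) θ = Complex.exp ((t : ℝ) * ψ θ)

/-- Additivity of `ψ` on the plane spanned by the coordinate directions `i` and `j`; for the
exponent of a Lévy process this is independence of the components `i` and `j`. -/
def AdditiveAlong {ι : Type*} [DecidableEq ι] (ψ : EuclideanSpace ℝ ι → ℂ) (i j : ι) : Prop :=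
  ∀ a b : ℝ, ψ (single i a + single j b) = ψ (single i a) + ψ (single j b)

theorem HasCharExponent.unique (hψ : HasCharExponent P X ψ) (hφ : HasCharExponent P X φ) :
    ψ = φ :=
  funext fun θ => eq_of_forall_exp_mul_eq fun t => (hψ t θ).symm.trans (hφ t θ)

theorem HasTriplet.hasCharExponent {ι : Type*} [Fintype ι] {X : ℝ≥0 → Ω → EuclideanSpace ℝ ι}
    {μ : EuclideanSpace ℝ ι} {S : Matrix ι ι ℝ} {ν : Measure (EuclideanSpace ℝ ι)}
    (hX : HasTriplet P X μ S ν) : HasCharExponent P X (levyExponent μ S ν) :=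
  hX.charFun_eq

theorem HasCharExponent.real_nonpos [IsProbabilityMeasure P]
    (hg : HasCharExponent P X fun θ => g θ) (hX : Measurable (X 1)) (θ : E) : g θ ≤ 0 := by
  have : IsProbabilityMeasure (P.map (X 1)) := Measure.isProbabilityMeasure_map hX.aemeasurable
  have h := norm_charFun_le_one (μ := P.map (X 1)) θ
  rwa [hg, NNReal.coe_one, Complex.ofReal_one, one_mul, Complex.norm_exp_ofReal,
    Real.exp_le_one_iff] at h

variable [BorelSpace E] [SecondCountableTopology E] {F : Type*} [NormedAddCommGroup F]
  [InnerProductSpace ℝ F] [MeasurableSpace F] [BorelSpace F] [SecondCountableTopology F]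

theorem charFun_map_eq_integral {U : Ω → E} (hU : AEMeasurable U P) (θ : E) :
    charFun (P.map U) θ = ∫ ω, Complex.exp ((inner ℝ (U ω) θ : ℝ) * Complex.I) ∂P := by
  rw [charFun_apply, integral_map hU (by fun_prop)]

theorem charFun_map_comp {L : E → F} {M : F → E} (hL : Measurable L)
    (hLM : ∀ x θ, inner ℝ (L x) θ = inner ℝ x (M θ)) {U : Ω → E} (hU : AEMeasurable U P) (θ : F) :
    charFun (P.map fun ω => L (U ω)) θ = charFun (P.map U) (M θ) := by
  have hLU : AEMeasurable (fun ω => L (U ω)) P := hL.comp_aemeasurable hU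
  rw [charFun_map_eq_integral hLU, charFun_map_eq_integral hU]
  simp only [hLM]

theorem indepFun_iff_charFun_single_add [IsProbabilityMeasure P] {ι : Type*} [Fintype ι]
    [DecidableEq ι] {U : Ω → EuclideanSpace ℝ ι} (hU : AEMeasurable U P)
    (i j : ι) : IndepFun (fun ω => U ω i) (fun ω => U ω j) P ↔ ∀ a b : ℝ,
      charFun (P.map U) (single i a + single j b) =
        charFun (P.map U) (single i a) * charFun (P.map U) (single j b) := by
  have hmarginal (k : ι) (a : ℝ) :
      charFun (P.map fun ω => U ω k) a = charFun (P.map U) (single k a) :=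
    charFun_map_comp (L := fun x => x k) (M := fun a => single k a) (by fun_prop)
      (fun x a => by simp [EuclideanSpace.inner_single_right]) hU a
  have hjoint (t : WithLp 2 (ℝ × ℝ)) :
      charFun (P.map fun ω => WithLp.toLp 2 (U ω i, U ω j)) t =
        charFun (P.map U) (single i t.ofLp.1 + single j t.ofLp.2) :=
    charFun_map_comp (L := fun x => WithLp.toLp 2 (x i, x j))
      (M := fun t : WithLp 2 (ℝ × ℝ) => single i t.ofLp.1 + single j t.ofLp.2) (by fun_prop)
      (fun x t => by simp [inner_add_right, EuclideanSpace.inner_single_right,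
        WithLp.prod_inner_apply]) hU t
  rw [indepFun_iff_charFun_prod (by fun_prop) (by fun_prop)]
  simp only [hmarginal, hjoint]
  exact ⟨fun h a b => h (WithLp.toLp 2 (a, b)), fun h t => h _ _⟩

theorem HasCharExponent.comp (hψ : HasCharExponent P X ψ) (hX : ∀ t, Measurable (X t)) {L : E → F}
    {M : F → E} (hL : Measurable L) (hLM : ∀ x θ, inner ℝ (L x) θ = inner ℝ x (M θ)) :
    HasCharExponent P (fun t ω => L (X t ω)) fun θ => ψ (M θ) := fun t θ => by
  rw [charFun_map_comp hL hLM (hX t).aemeasurable, hψ]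

theorem HasCharExponent.exists_real (hψ : HasCharExponent P X ψ) (hX : ∀ t, Measurable (X t))
    (hsymm : ∀ t, IdentDistrib (X t) (fun ω => -X t ω) P P) :
    ∃ g : E → ℝ, HasCharExponent P X fun θ => g θ := by
  have hneg : HasCharExponent P X fun θ => ψ (-θ) := fun t θ => by
    rw [(hsymm t).map_eq]
    exact hψ.comp hX measurable_neg (fun x θ => by rw [inner_neg_left, inner_neg_right]) t θ
  have hconj : HasCharExponent P X fun θ => (starRingEnd ℂ) (ψ (-θ)) := fun t θ => by
    rw [← Complex.conj_ofReal, ← map_mul, Complex.exp_conj, ← hψ, charFun_neg, Complex.conj_conj]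
  have hreal (θ : E) : (starRingEnd ℂ) (ψ θ) = ψ θ := by
    simpa using congrFun (hconj.unique hneg) (-θ)
  refine ⟨fun θ => (ψ θ).re, ?_⟩
  simpa only [Complex.conj_eq_iff_re.1 (hreal _)] using hψ

theorem HasCharExponent.forall_indepFun_iff [IsProbabilityMeasure P] {ι : Type*} [Fintype ι]
    [DecidableEq ι] {X : ℝ≥0 → Ω → EuclideanSpace ℝ ι} {ψ : EuclideanSpace ℝ ι → ℂ}
    (hψ : HasCharExponent P X ψ) (hX : ∀ t, Measurable (X t)) {i j : ι} :
    (∀ t, IndepFun (fun ω => X t ω i) (fun ω => X t ω j) P) ↔ AdditiveAlong ψ i j := by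
  simp only [indepFun_iff_charFun_single_add (hX _).aemeasurable, hψ _ _, ← Complex.exp_add,
    ← mul_add]
  exact ⟨fun h a b => eq_of_forall_exp_mul_eq fun t => h t a b, fun h t a b => by rw [h a b]⟩

end CharExponent

section FiniteVariation

variable {ι : Type*} [Fintype ι] {ν : Measure (EuclideanSpace ℝ ι)}

/-- The characteristic exponent `∫ (e^{i⟨θ,t⟩} - 1) ν(dt)` of a drift-less pure jump process of
finite variation. -/
def jumpExponent (ν : Measure (EuclideanSpace ℝ ι)) (θ : EuclideanSpace ℝ ι) : ℂ :=
  ∫ t, (Complex.exp (Complex.I * (inner ℝ θ t : ℝ)) - 1) ∂ν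

theorem norm_exp_I_mul_sub_one_le_two (x : ℝ) : ‖Complex.exp (Complex.I * x) - 1‖ ≤ 2 := by
  refine (norm_sub_le _ _).trans_eq ?_
  rw [Complex.norm_exp_I_mul_ofReal, norm_one]
  norm_num

theorem norm_exp_inner_sub_one_le (θ t : EuclideanSpace ℝ ι) :
    ‖Complex.exp (Complex.I * (inner ℝ θ t : ℝ)) - 1‖ ≤ 2 * max ‖θ‖ 1 * min ‖t‖ 1 := by
  have hlin : ‖Complex.exp (Complex.I * (inner ℝ θ t : ℝ)) - 1‖ ≤ ‖θ‖ * ‖t‖ :=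
    Real.norm_exp_I_mul_ofReal_sub_one_le.trans (norm_inner_le_norm θ t)
  have htwo := norm_exp_I_mul_sub_one_le_two (inner ℝ θ t)
  have hθ := le_max_left ‖θ‖ 1
  have hone := le_max_right ‖θ‖ 1
  rcases le_total ‖t‖ 1 with h | h
  · rw [min_eq_left h]
    nlinarith [norm_nonneg t]
  · rw [min_eq_right h]
    linarith

theorem integrable_exp_inner_sub_one (hν : Integrable (fun t => min ‖t‖ 1) ν)
    (θ : EuclideanSpace ℝ ι) :
    Integrable (fun t => Complex.exp (Complex.I * (inner ℝ θ t : ℝ)) - 1) ν :=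
  (hν.const_mul (2 * max ‖θ‖ 1)).mono' (by fun_prop)
    (ae_of_all _ fun t => norm_exp_inner_sub_one_le θ t)

theorem norm_exp_inner_smul_sub_one_div_le (n : ℕ) (θ t : EuclideanSpace ℝ ι) :
    ‖(Complex.exp (Complex.I * (inner ℝ ((n : ℝ) • θ) t : ℝ)) - 1) / (n : ℂ)‖ ≤
      2 * max ‖θ‖ 1 * min ‖t‖ 1 := by
  rw [norm_div, Complex.norm_natCast]
  rcases Nat.eq_zero_or_pos n with rfl | hn
  · rw [Nat.cast_zero, div_zero]
    positivity
  · have hn1 : (1 : ℝ) ≤ n := by exact_mod_cast hn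
    have hmax : max ‖(n : ℝ) • θ‖ 1 ≤ n * max ‖θ‖ 1 := by
      rw [norm_smul, Real.norm_natCast, mul_max_of_nonneg _ _ n.cast_nonneg, mul_one]
      exact max_le_max le_rfl hn1
    rw [div_le_iff₀ (by positivity)]
    calc ‖Complex.exp (Complex.I * (inner ℝ ((n : ℝ) • θ) t : ℝ)) - 1‖
        ≤ 2 * max ‖(n : ℝ) • θ‖ 1 * min ‖t‖ 1 := norm_exp_inner_sub_one_le _ t
      _ ≤ 2 * (n * max ‖θ‖ 1) * min ‖t‖ 1 := by gcongr
      _ = 2 * max ‖θ‖ 1 * min ‖t‖ 1 * n := by ring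

theorem tendsto_jumpExponent_div (hν : Integrable (fun t => min ‖t‖ 1) ν)
    (θ : EuclideanSpace ℝ ι) :
    Tendsto (fun n : ℕ => jumpExponent ν ((n : ℝ) • θ) / (n : ℂ)) atTop (𝓝 0) := by
  have hpointwise (t : EuclideanSpace ℝ ι) : Tendsto (fun n : ℕ =>
      (Complex.exp (Complex.I * (inner ℝ ((n : ℝ) • θ) t : ℝ)) - 1) / (n : ℂ)) atTop (𝓝 0) := by
    refine squeeze_zero_norm (fun n => ?_) (tendsto_const_div_atTop_nhds_zero_nat 2)
    rw [norm_div, Complex.norm_natCast]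
    gcongr
    exact norm_exp_I_mul_sub_one_le_two _
  simpa only [jumpExponent, integral_div, integral_zero] using
    tendsto_integral_of_dominated_convergence _ (fun n => by fun_prop) (hν.const_mul _)
      (fun n => ae_of_all _ (norm_exp_inner_smul_sub_one_div_le n θ)) (ae_of_all _ hpointwise)

end FiniteVariation

section Drift

open EuclideanSpace (single)

variable {Ω : Type*} [MeasurableSpace Ω] {P : Measure Ω} {ι : Type*} [Fintype ι]
  {T : ℝ≥0 → Ω → EuclideanSpace ℝ ι} {d : EuclideanSpace ℝ ι} {ν : Measure (EuclideanSpace ℝ ι)}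

theorem HasDrift.integrable_min_norm (h : HasDrift P T d ν) :
    Integrable (fun t => min ‖t‖ 1) ν := by
  refine ⟨by fun_prop, ?_⟩
  rw [hasFiniteIntegral_iff_ofReal (ae_of_all _ fun t => by positivity),
    ← lintegral_add_compl _ (Metric.isClosed_closedBall (x := (0 : EuclideanSpace ℝ ι))
      (ε := 1)).measurableSet]
  refine ENNReal.add_lt_top.2 ⟨lt_of_le_of_lt ?_ h.finiteVariation,
    lt_of_le_of_lt ?_ h.triplet.levyMeasure.2⟩
  · exact lintegral_mono fun t => ENNReal.ofReal_le_ofReal (min_le_left _ _)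
  · refine le_trans (setLIntegral_mono (by fun_prop) fun t ht => ?_) (setLIntegral_le_lintegral _ _)
    have hnorm : 1 < ‖t‖ := by simpa using ht
    rw [min_eq_right hnorm.le, min_eq_right (one_le_pow₀ hnorm.le)]

theorem HasDrift.integrableOn_closedBall (h : HasDrift P T d ν) :
    IntegrableOn (fun t => t) (Metric.closedBall 0 1) ν :=
  ⟨by fun_prop, hasFiniteIntegral_iff_norm _ |>.2 h.finiteVariation⟩

theorem HasDrift.levyExponent_eq (h : HasDrift P T d ν) (θ : EuclideanSpace ℝ ι) :
    levyExponent (d + ∫ t in Metric.closedBall 0 1, t ∂ν) 0 ν θ =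
      Complex.I * (inner ℝ d θ : ℝ) + jumpExponent ν θ := by
  have hball : MeasurableSet (Metric.closedBall (0 : EuclideanSpace ℝ ι) 1) :=
    Metric.isClosed_closedBall.measurableSet
  have hind : (fun t : EuclideanSpace ℝ ι => if ‖t‖ ≤ 1 then (inner ℝ θ t : ℝ) else 0) =
      (Metric.closedBall 0 1).indicator fun t => inner ℝ θ t := by
    funext t
    simp [Set.indicator]
  have hint : Integrable (fun t : EuclideanSpace ℝ ι =>
      if ‖t‖ ≤ 1 then (inner ℝ θ t : ℝ) else 0) ν := by
    rw [hind, integrable_indicator_iff hball]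
    exact h.integrableOn_closedBall.const_inner θ
  have hcompensator : ∫ t : EuclideanSpace ℝ ι, (if ‖t‖ ≤ 1 then (inner ℝ θ t : ℝ) else 0) ∂ν =
      inner ℝ θ (∫ t in Metric.closedBall 0 1, t ∂ν) := by
    rw [hind, integral_indicator hball]
    exact integral_inner h.integrableOn_closedBall θ
  have hint' : Integrable (fun t : EuclideanSpace ℝ ι =>
      Complex.I * ((if ‖t‖ ≤ 1 then (inner ℝ θ t : ℝ) else 0 : ℝ) : ℂ)) ν := hint.ofReal.const_mul _
  have hsplit := integral_sub (integrable_exp_inner_sub_one h.integrable_min_norm θ) hint'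
  rw [integral_const_mul, integral_complex_ofReal, hcompensator] at hsplit
  rw [levyExponent, hsplit, jumpExponent, inner_add_left,
    real_inner_comm θ (∫ t in Metric.closedBall 0 1, t ∂ν)]
  simp only [Matrix.zero_apply, mul_zero, zero_mul, Finset.sum_const_zero, Complex.ofReal_zero,
    Complex.ofReal_add]
  ring

theorem HasDrift.hasCharExponent (h : HasDrift P T d ν) :
    HasCharExponent P T fun θ => Complex.I * (inner ℝ d θ : ℝ) + jumpExponent ν θ := fun t θ => by
  rw [h.triplet.charFun_eq, h.levyExponent_eq]

theorem HasDrift.drift_eq_zero (h : HasDrift P T d ν) (k : ι)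
    (hk : IsDriftless P (scalar (component T k))) : d k = 0 := by
  classical
  obtain ⟨ν', h'⟩ := hk
  have hcomponent : HasCharExponent P (scalar (component T k)) fun θ =>
      Complex.I * (inner ℝ d (single k (θ 0)) : ℝ) + jumpExponent ν (single k (θ 0)) :=
    h.hasCharExponent.comp h.subordinator.levy.measurable (L := fun x => !₂[x k]) (by fun_prop)
      fun x θ => by simp [PiLp.inner_apply, mul_comm]
  have hexp (n : ℕ) : Complex.I * (n * d k) + jumpExponent ν ((n : ℝ) • single k 1) =
      jumpExponent ν' ((n : ℝ) • single 0 1) := by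
    have hsmul : (single k (n : ℝ) : EuclideanSpace ℝ ι) = (n : ℝ) • single k 1 := by
      ext l
      simp
    have hvalue : ((n : ℝ) • single (0 : Fin 1) (1 : ℝ) : EuclideanSpace ℝ (Fin 1)) 0 = n := by
      simp
    have heq := congrFun (hcomponent.unique h'.hasCharExponent) ((n : ℝ) • single 0 1)
    simp only [hvalue, hsmul, inner_zero_left, Complex.ofReal_zero, mul_zero, zero_add] at heq
    rw [← heq]
    simp [inner_smul_right, EuclideanSpace.inner_single_right]
  have hlim := (tendsto_jumpExponent_div h'.integrable_min_norm (single 0 1)).sub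
    (tendsto_jumpExponent_div h.integrable_min_norm (single k 1))
  have hconst : Tendsto (fun _ : ℕ => Complex.I * (d k : ℂ)) atTop (𝓝 0) := by
    rw [sub_zero] at hlim
    refine hlim.congr' ?_
    filter_upwards [eventually_ne_atTop 0] with n hn
    have hn' : (n : ℂ) ≠ 0 := Nat.cast_ne_zero.2 hn
    rw [← hexp n]
    field_simp
    ring
  simpa using tendsto_nhds_unique tendsto_const_nhds hconst

end Drift

section Axes

open EuclideanSpace (single)

theorem eq_zero_or_eq_zero_of_forall_cos {x y : ℝ}
    (h : ∀ n : ℕ, (1 - Real.cos (1 / ((n : ℝ) + 1) * x)) *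
      (1 - Real.cos (1 / ((n : ℝ) + 1) * y)) = 0) : x = 0 ∨ y = 0 := by
  have hsmall (z : ℝ) : ∀ᶠ n : ℕ in atTop, |1 / ((n : ℝ) + 1) * z| < 1 := by
    have hz : Tendsto (fun n : ℕ => |1 / ((n : ℝ) + 1) * z|) atTop (𝓝 0) := by
      simpa using ((tendsto_one_div_add_atTop_nhds_zero_nat (𝕜 := ℝ)).mul_const z).abs
    exact hz.eventually_lt_const one_pos
  obtain ⟨n, hx, hy⟩ := ((hsmall x).and (hsmall y)).exists
  have hcos {z : ℝ} (hz : |1 / ((n : ℝ) + 1) * z| < 1)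
      (hcos : 1 - Real.cos (1 / ((n : ℝ) + 1) * z) = 0) : z = 0 := by
    rw [abs_lt] at hz
    have hpi := Real.pi_gt_three
    have hmul := (Real.cos_eq_one_iff_of_lt_of_lt (by linarith) (by linarith)).1
      (sub_eq_zero.1 hcos).symm
    exact (mul_eq_zero.1 hmul).resolve_left (by positivity)
  exact (mul_eq_zero.1 (h n)).imp (hcos hx) (hcos hy)

variable {ι : Type*} [Fintype ι] {ν : Measure (EuclideanSpace ℝ ι)}

theorem exp_inner_sub_one_mul (θ η t : EuclideanSpace ℝ ι) :
    (Complex.exp (Complex.I * (inner ℝ θ t : ℝ)) - 1) *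
        (Complex.exp (Complex.I * (inner ℝ η t : ℝ)) - 1) =
      Complex.exp (Complex.I * (inner ℝ (θ + η) t : ℝ)) - 1 -
        (Complex.exp (Complex.I * (inner ℝ θ t : ℝ)) - 1) -
        (Complex.exp (Complex.I * (inner ℝ η t : ℝ)) - 1) := by
  rw [inner_add_left, Complex.ofReal_add, mul_add, Complex.exp_add]
  ring

theorem integrable_exp_inner_sub_one_mul (hν : Integrable (fun t => min ‖t‖ 1) ν)
    (θ η : EuclideanSpace ℝ ι) :
    Integrable (fun t => (Complex.exp (Complex.I * (inner ℝ θ t : ℝ)) - 1) *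
      (Complex.exp (Complex.I * (inner ℝ η t : ℝ)) - 1)) ν := by
  simp only [exp_inner_sub_one_mul]
  exact ((integrable_exp_inner_sub_one hν _).sub (integrable_exp_inner_sub_one hν θ)).sub
    (integrable_exp_inner_sub_one hν η)

theorem integral_exp_inner_sub_one_mul (hν : Integrable (fun t => min ‖t‖ 1) ν)
    (θ η : EuclideanSpace ℝ ι) :
    ∫ t, (Complex.exp (Complex.I * (inner ℝ θ t : ℝ)) - 1) *
        (Complex.exp (Complex.I * (inner ℝ η t : ℝ)) - 1) ∂ν =
      jumpExponent ν (θ + η) - jumpExponent ν θ - jumpExponent ν η := by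
  have hint := integrable_exp_inner_sub_one hν
  simp only [exp_inner_sub_one_mul]
  exact (integral_sub' ((hint _).sub (hint θ)) (hint η)).trans
    (congrArg (· - jumpExponent ν η) (integral_sub' (hint _) (hint θ)))

theorem ae_cos_inner_mul_eq_zero (hν : Integrable (fun t => min ‖t‖ 1) ν)
    {θ η : EuclideanSpace ℝ ι}
    (hadd : jumpExponent ν (θ + η) = jumpExponent ν θ + jumpExponent ν η)
    (hsub : jumpExponent ν (θ + -η) = jumpExponent ν θ + jumpExponent ν (-η)) :
    ∀ᵐ t ∂ν, (1 - Real.cos (inner ℝ θ t)) * (1 - Real.cos (inner ℝ η t)) = 0 := by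
  have hint := (integrable_exp_inner_sub_one_mul hν θ η).add
    (integrable_exp_inner_sub_one_mul hν θ (-η))
  have hzero := integral_add (integrable_exp_inner_sub_one_mul hν θ η)
    (integrable_exp_inner_sub_one_mul hν θ (-η))
  rw [integral_exp_inner_sub_one_mul hν, integral_exp_inner_sub_one_mul hν, hadd, hsub,
    add_sub_cancel_left, sub_self, add_sub_cancel_left, sub_self, add_zero] at hzero
  have hre (t : EuclideanSpace ℝ ι) :
      ((Complex.exp (Complex.I * (inner ℝ θ t : ℝ)) - 1) *
        (Complex.exp (Complex.I * (inner ℝ η t : ℝ)) - 1) +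
        (Complex.exp (Complex.I * (inner ℝ θ t : ℝ)) - 1) *
        (Complex.exp (Complex.I * (inner ℝ (-η) t : ℝ)) - 1)).re =
      2 * ((1 - Real.cos (inner ℝ θ t)) * (1 - Real.cos (inner ℝ η t))) := by
    rw [exp_inner_sub_one_mul, exp_inner_sub_one_mul]
    simp only [mul_comm Complex.I, Complex.add_re, Complex.sub_re,
      Complex.exp_ofReal_mul_I_re, Complex.one_re, inner_add_left, inner_neg_left, Real.cos_add,
      Real.cos_neg, Real.sin_neg]
    ring
  have hreal := integral_re hint
  simp only [RCLike.re_to_complex, Pi.add_apply, hre, hzero, Complex.zero_re] at hreal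
  have hnonneg (t : EuclideanSpace ℝ ι) :
      0 ≤ 2 * ((1 - Real.cos (inner ℝ θ t)) * (1 - Real.cos (inner ℝ η t))) :=
    mul_nonneg zero_le_two (mul_nonneg (sub_nonneg.2 (Real.cos_le_one _))
      (sub_nonneg.2 (Real.cos_le_one _)))
  have hint' := hint.re
  simp only [RCLike.re_to_complex, Pi.add_apply, hre] at hint'
  filter_upwards [(integral_eq_zero_iff_of_nonneg hnonneg hint').1 hreal] with t ht
  exact (mul_eq_zero.1 ht).resolve_left two_ne_zero

theorem AdditiveAlong.ae_eq_zero_or_eq_zero [DecidableEq ι] {i j : ι}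
    (h : AdditiveAlong (jumpExponent ν) i j) (hν : Integrable (fun t => min ‖t‖ 1) ν) :
    ∀ᵐ t ∂ν, t i = 0 ∨ t j = 0 := by
  have hcos (a : ℝ) : ∀ᵐ t ∂ν, (1 - Real.cos (a * t i)) * (1 - Real.cos (a * t j)) = 0 := by
    have hneg : -single j a = single j (-a) := (PiLp.single_neg ..).symm
    have hae := ae_cos_inner_mul_eq_zero hν (h a a) (by rw [hneg]; exact h a (-a))
    simpa [EuclideanSpace.inner_single_left, mul_comm] using hae
  filter_upwards [ae_all_iff.2 fun n : ℕ => hcos (1 / ((n : ℝ) + 1))] with t ht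
  exact eq_zero_or_eq_zero_of_forall_cos ht

variable {Ω : Type*} [MeasurableSpace Ω] {P : Measure Ω} [IsProbabilityMeasure P]
  {T : ℝ≥0 → Ω → EuclideanSpace ℝ ι} {d : EuclideanSpace ℝ ι}

theorem HasDrift.ae_eq_zero_or_eq_zero (h : HasDrift P T d ν) {i j : ι}
    (hind : ∀ t, IndepFun (fun ω => T t ω i) (fun ω => T t ω j) P) :
    ∀ᵐ t ∂ν, t i = 0 ∨ t j = 0 := by
  classical
  have hadd := (h.hasCharExponent.forall_indepFun_iff h.subordinator.levy.measurable).1 hind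
  refine AdditiveAlong.ae_eq_zero_or_eq_zero (fun a b => ?_) h.integrable_min_norm
  have hab := hadd a b
  simp only [inner_add_right, Complex.ofReal_add] at hab
  linear_combination hab

end Axes

section ComponentProcesses

variable {Ω : Type*} [MeasurableSpace Ω] {P : Measure Ω}

theorem exists_monotone_seq (K : Finset ℝ≥0) :
    ∃ t : ℕ → ℝ≥0, Monotone t ∧ t 0 = 0 ∧ ∀ s ∈ K, ∃ n, t n = s := by
  classical
  have hK : 0 < (insert 0 K).card := Finset.card_pos.2 (Finset.insert_nonempty 0 K)
  let e := (insert 0 K).orderEmbOfFin rfl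
  have hrange (s : ℝ≥0) (hs : s ∈ insert 0 K) : ∃ i, e i = s := by
    rwa [← Set.mem_range, Finset.range_orderEmbOfFin]
  refine ⟨fun n => e ⟨min n ((insert 0 K).card - 1), by omega⟩, fun m n hmn => ?_, ?_,
    fun s hs => ?_⟩
  · exact e.monotone (Fin.mk_le_mk.2 (by omega))
  · obtain ⟨i, hi⟩ := hrange 0 (Finset.mem_insert_self 0 K)
    exact le_antisymm ((e.monotone (Fin.mk_le_mk.2 (by omega))).trans hi.le) zero_le
  · obtain ⟨i, hi⟩ := hrange s (Finset.mem_insert_of_mem hs)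
    exact ⟨i, (congrArg e (Fin.ext (Nat.min_eq_left (by omega)))).trans hi⟩

theorem iIndepFun_fin_two_of_indepFun [IsProbabilityMeasure P] {β : Type*} [MeasurableSpace β]
    {f : Fin 2 → Ω → β} (h : IndepFun (f 0) (f 1) P) : iIndepFun f P := by
  rw [iIndepFun_iff_measure_inter_preimage_eq_mul]
  intro S sets hsets
  have hS : ∀ S : Finset (Fin 2), S = ∅ ∨ S = {0} ∨ S = {1} ∨ S = {0, 1} := by decide
  rcases hS S with rfl | rfl | rfl | rfl
  · simp
  · simp
  · simp
  · simpa using h.measure_inter_preimage_eq_mul _ _ (hsets 0 (by simp)) (hsets 1 (by simp))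

theorem indepFun_pi_of_forall_indepFun {κ β : Type*} [MeasurableSpace β] {W : κ → Fin 2 → Ω → β}
    (hW : ∀ n k, Measurable (W n k)) (hrow : iIndepFun (fun n ω k => W n k ω) P)
    (h : ∀ n, IndepFun (W n 0) (W n 1) P) :
    IndepFun (fun ω n => W n 0 ω) (fun ω n => W n 1 ω) P := by
  have := hrow.isProbabilityMeasure
  have hall : iIndepFun (fun (p : κ × Fin 2) ω => W p.1 p.2 ω) P :=
    iIndepFun_uncurry' hW hrow fun n => iIndepFun_fin_two_of_indepFun (h n)
  refine IndepFun.process_indepFun_process (fun n => hW n 0) (fun n => hW n 1) fun I J => ?_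
  have hdisj : Disjoint (I ×ˢ ({0} : Finset (Fin 2))) (J ×ˢ ({1} : Finset (Fin 2))) :=
    Finset.disjoint_product.2 (Or.inr (by simp))
  exact (hall.indepFun_finset _ _ hdisj fun p => hW p.1 p.2).comp
    (φ := fun (w : ↥(I ×ˢ ({0} : Finset (Fin 2))) → β) (n : I) => w ⟨(n, 0), by simp⟩)
    (ψ := fun (w : ↥(J ×ˢ ({1} : Finset (Fin 2))) → β) (n : J) => w ⟨(n, 1), by simp⟩)
    (by fun_prop) (by fun_prop)

variable {ι : Type*} [Finite ι] {X : ℝ≥0 → Ω → EuclideanSpace ℝ ι}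

theorem IsLevyProcess.indepFun_increment_apply [IsProbabilityMeasure P] (hX : IsLevyProcess P X)
    {i j : ι} (h : ∀ t, IndepFun (fun ω => X t ω i) (fun ω => X t ω j) P) {s t : ℝ≥0}
    (hst : s ≤ t) :
    IndepFun (fun ω => X t ω i - X s ω i) (fun ω => X t ω j - X s ω j) P := by
  classical
  have := Fintype.ofFinite ι
  have hs := hX.measurable s
  have ht := hX.measurable t
  refine (indepFun_iff_charFun_single_add (U := fun ω => X t ω - X s ω) (by fun_prop) i j).2 ?_
  rw [(hX.identDistrib_increment hst).map_eq]
  exact (indepFun_iff_charFun_single_add (hX.measurable _).aemeasurable i j).1 (h _)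

theorem IsLevyProcess.indepFun_component [IsProbabilityMeasure P] (hX : IsLevyProcess P X)
    {i j : ι} (h : ∀ t, IndepFun (fun ω => X t ω i) (fun ω => X t ω j) P) :
    IndepFun (path (component X i)) (path (component X j)) P := by
  have hm (t : ℝ≥0) (k : ι) : Measurable (fun ω => X t ω k) := by
    have := hX.measurable t
    fun_prop
  refine IndepFun.process_indepFun_process (X := component X i) (Y := component X j)
    (fun t => hm t i) (fun t => hm t j) fun I J => ?_
  classical
  obtain ⟨t, ht, ht0, hIJ⟩ := exists_monotone_seq (I ∪ J)
  choose! n hn using hIJ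
  let W (m : ℕ) (k : Fin 2) (ω : Ω) : ℝ := X (t (m + 1)) ω (![i, j] k) - X (t m) ω (![i, j] k)
  have hrow : iIndepFun (fun m ω k => W m k ω) P :=
    (hX.indepIncrements.nat ht).comp
      (fun _ (x : EuclideanSpace ℝ ι) k => x (![i, j] k)) fun _ => by fun_prop
  have hseq : IndepFun (fun ω m => W m 0 ω) (fun ω m => W m 1 ω) P :=
    indepFun_pi_of_forall_indepFun (fun m k => (hm _ _).sub (hm _ _)) hrow fun m =>
      hX.indepFun_increment_apply h (ht m.le_succ)
  have htelescope (k : Fin 2) : ∀ᵐ ω ∂P, ∀ s ∈ I ∪ J,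
      ∑ m ∈ Finset.range (n s), W m k ω = component X (![i, j] k) s ω := by
    filter_upwards [hX.zero] with ω hω s hs
    rw [Finset.sum_range_sub fun m => X (t m) ω (![i, j] k), hn s hs, ht0, hω, PiLp.zero_apply,
      sub_zero, component]
  refine (hseq.comp (φ := fun w (s : I) => ∑ m ∈ Finset.range (n s), w m)
    (ψ := fun w (s : J) => ∑ m ∈ Finset.range (n s), w m) (by fun_prop) (by fun_prop)).congr ?_ ?_
  · filter_upwards [htelescope 0] with ω hω
    exact funext fun s => hω s (Finset.mem_union_left _ s.2)
  · filter_upwards [htelescope 1] with ω hω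
    exact funext fun s => hω s (Finset.mem_union_right _ s.2)

end ComponentProcesses

section LevyExponent

variable {ι : Type*} [Fintype ι] {ν : Measure (EuclideanSpace ℝ ι)}

/-- The integrand `e^{i⟨θ,x⟩} - 1 - i⟨θ,x⟩ 1_{‖x‖ ≤ 1}` of the Lévy exponent. -/
def levyIntegrand (θ x : EuclideanSpace ℝ ι) : ℂ :=
  Complex.exp (Complex.I * (inner ℝ θ x : ℝ)) - 1 -
    Complex.I * (if ‖x‖ ≤ 1 then (inner ℝ θ x : ℝ) else 0 : ℝ)

theorem norm_exp_I_mul_sub_one_sub_le (x : ℝ) :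
    ‖Complex.exp (Complex.I * x) - 1 - Complex.I * x‖ ≤ 3 * x ^ 2 := by
  have hnorm : ‖Complex.I * x‖ = |x| := by
    rw [norm_mul, Complex.norm_I, one_mul, Complex.norm_real, Real.norm_eq_abs]
  rcases le_total |x| 1 with h | h
  · have hquadratic := Complex.norm_exp_sub_one_sub_id_le (hnorm.trans_le h)
    rw [hnorm, sq_abs] at hquadratic
    nlinarith [sq_nonneg x]
  · have hlinear : ‖Complex.exp (Complex.I * x) - 1‖ ≤ |x| :=
      Real.norm_exp_I_mul_ofReal_sub_one_le
    refine (norm_sub_le _ _).trans ?_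
    rw [hnorm]
    nlinarith [sq_abs x]

theorem norm_levyIntegrand_le (θ x : EuclideanSpace ℝ ι) :
    ‖levyIntegrand θ x‖ ≤ (3 * ‖θ‖ ^ 2 + 2) * min (‖x‖ ^ 2) 1 := by
  rw [levyIntegrand]
  split_ifs with hx
  · rw [min_eq_left (pow_le_one₀ (norm_nonneg x) hx)]
    have hinner : (inner ℝ θ x) ^ 2 ≤ (‖θ‖ * ‖x‖) ^ 2 := by
      rw [← sq_abs]
      gcongr
      exact abs_real_inner_le_norm θ x
    nlinarith [norm_exp_I_mul_sub_one_sub_le (inner ℝ θ x), sq_nonneg ‖x‖]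
  · rw [min_eq_right (one_le_pow₀ (not_le.1 hx).le), Complex.ofReal_zero, mul_zero, sub_zero]
    nlinarith [norm_exp_I_mul_sub_one_le_two (inner ℝ θ x), sq_nonneg ‖θ‖]

theorem measurable_levyIntegrand (θ : EuclideanSpace ℝ ι) : Measurable (levyIntegrand θ) := by
  have hcompensator : Measurable fun x : EuclideanSpace ℝ ι =>
      if ‖x‖ ≤ 1 then (inner ℝ θ x : ℝ) else 0 :=
    Measurable.ite (measurableSet_le measurable_norm measurable_const) (by fun_prop)
      measurable_const
  unfold levyIntegrand
  fun_prop

theorem integrable_levyIntegrand (hν : IsLevyMeasure ν) (θ : EuclideanSpace ℝ ι) :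
    Integrable (levyIntegrand θ) ν := by
  have hmin : Integrable (fun x => min (‖x‖ ^ 2) 1) ν :=
    ⟨by fun_prop, (hasFiniteIntegral_iff_ofReal (ae_of_all _ fun x => by positivity)).2 hν.2⟩
  exact (hmin.const_mul _).mono' (measurable_levyIntegrand θ).aestronglyMeasurable
    (ae_of_all _ (norm_levyIntegrand_le θ))

theorem levyExponent_zero_covariance (m θ : EuclideanSpace ℝ ι) :
    levyExponent m 0 ν θ = Complex.I * (inner ℝ m θ : ℝ) + ∫ x, levyIntegrand θ x ∂ν := by
  simp [levyExponent, levyIntegrand]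

theorem levyExponent_add (hν : IsLevyMeasure ν) (m : EuclideanSpace ℝ ι)
    {θ η : EuclideanSpace ℝ ι} (h : ∀ᵐ x ∂ν, inner ℝ θ x = 0 ∨ inner ℝ η x = 0) :
    levyExponent m 0 ν (θ + η) = levyExponent m 0 ν θ + levyExponent m 0 ν η := by
  have hintegrand : ∫ x, levyIntegrand (θ + η) x ∂ν =
      ∫ x, levyIntegrand θ x ∂ν + ∫ x, levyIntegrand η x ∂ν := by
    rw [← integral_add (integrable_levyIntegrand hν θ) (integrable_levyIntegrand hν η)]
    refine integral_congr_ae ?_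
    filter_upwards [h] with x hx
    rcases hx with hx | hx <;> simp [levyIntegrand, inner_add_left, hx]
  rw [levyExponent_zero_covariance, levyExponent_zero_covariance, levyExponent_zero_covariance,
    hintegrand, inner_add_right, Complex.ofReal_add]
  ring

end LevyExponent

section WeakExponent

open EuclideanSpace (single)

variable {Ω : Type*} [MeasurableSpace Ω] {P : Measure Ω} {n : ℕ}
  {T X : ℝ≥0 → Ω → EuclideanSpace ℝ (Fin n)}

theorem weakCov_zero (S : Matrix (Fin n) (Fin n) ℝ) : weakCov 0 S = 0 := by
  have houter : outerMatrix 0 S = 0 := by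
    ext k l
    simp [outerMatrix]
  rw [weakCov, houter, Matrix.fromBlocks_zero]

theorem outerMeasure_zero (ν : Measure (EuclideanSpace ℝ (Fin n))) : outerMeasure 0 ν = 0 := by
  simp [outerMeasure, spacing]

variable {i j : Fin n}

theorem ae_weakLevyMeasure_zero {𝒯 : Measure (EuclideanSpace ℝ (Fin n))} (hX : ∀ᵐ ω ∂P, X 0 ω = 0)
    (h𝒯 : ∀ᵐ t ∂𝒯, t i = 0 ∨ t j = 0) (𝒳 : Measure (EuclideanSpace ℝ (Fin n))) :
    ∀ᵐ z ∂(weakLevyMeasure P X 0 𝒯 𝒳), z (Sum.inr i) = 0 ∨ z (Sum.inr j) = 0 := by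
  rw [weakLevyMeasure, outerMeasure_zero, Measure.map_zero, zero_add]
  by_cases hpair : AEMeasurable (fun p : EuclideanSpace ℝ (Fin n) × Ω =>
      pair p.1 (multiTime X p.1 p.2)) ((𝒯.restrict (orthant (Fin n))).prod P)
  · refine (ae_map_iff hpair ?_).2 ?_
    · exact (measurableSet_eq_fun (by fun_prop) (by fun_prop)).union
        (measurableSet_eq_fun (by fun_prop) (by fun_prop))
    filter_upwards [Measure.quasiMeasurePreserving_fst.ae (ae_restrict_of_ae h𝒯),
      Measure.quasiMeasurePreserving_snd.ae hX] with p hp hω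
    exact hp.imp (fun h => by simp [pair, multiTime, h, hω]) fun h => by
      simp [pair, multiTime, h, hω]
  · rw [Measure.map_of_not_aemeasurable hpair, ae_zero]
    exact eventually_bot

theorem IsWeakSubordination.indepFun_second [IsProbabilityMeasure P] {Ω' : Type*}
    [MeasurableSpace Ω'] {R : Measure Ω'} [IsProbabilityMeasure R]
    {Z : ℝ≥0 → Ω' → EuclideanSpace ℝ (Fin n ⊕ Fin n)} (h : IsWeakSubordination P T X R Z)
    (hind : ∀ t, IndepFun (fun ω => T t ω i) (fun ω => T t ω j) P)
    (hdrift : ∀ k, IsDriftless P (scalar (component T k))) (t : ℝ≥0) :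
    IndepFun (fun ω => second Z t ω i) (fun ω => second Z t ω j) R := by
  obtain ⟨d, 𝒯, μ, S, 𝒳, hT, hX, hZ⟩ := h
  obtain rfl : d = 0 := PiLp.ext fun k => hT.drift_eq_zero k (hdrift k)
  have hjumps := ae_weakLevyMeasure_zero hX.levy.zero (hT.ae_eq_zero_or_eq_zero hind) 𝒳
  refine (hZ.hasCharExponent.forall_indepFun_iff hZ.levy.measurable (i := Sum.inr i)
    (j := Sum.inr j)).2 (fun a b => ?_) t
  rw [weakCov_zero]
  refine levyExponent_add hZ.levyMeasure _ ?_
  filter_upwards [hjumps] with z hz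
  exact hz.imp (fun h => by simp [EuclideanSpace.inner_single_left, h]) fun h => by
    simp [EuclideanSpace.inner_single_left, h]

end WeakExponent

section RealExponent

open EuclideanSpace (single)

variable {Ω : Type*} [MeasurableSpace Ω] {P : Measure Ω} {ι : Type*}
  {X T : ℝ≥0 → Ω → EuclideanSpace ℝ ι}

theorem integrable_exp_of_ae_nonpos [IsFiniteMeasure P] {f : Ω → ℝ} (hf : Measurable f)
    (h : ∀ᵐ ω ∂P, f ω ≤ 0) : Integrable (fun ω => Real.exp (f ω)) P := by
  refine Integrable.of_bound (Measurable.aestronglyMeasurable (by fun_prop)) 1 ?_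
  filter_upwards [h] with ω hω
  rwa [Real.norm_eq_abs, Real.abs_exp, Real.exp_le_one_iff]

theorem ae_eq_zero_of_integral_exp_add_mul_eq {f m : Ω → ℝ} {c : ℝ}
    (hf : Integrable (fun ω => Real.exp (f ω)) P)
    (hfm : Integrable (fun ω => Real.exp (f ω + m ω * c)) P) (hm : ∀ᵐ ω ∂P, 0 ≤ m ω) (hc : c ≠ 0)
    (h : ∫ ω, Real.exp (f ω + m ω * c) ∂P = ∫ ω, Real.exp (f ω) ∂P) : ∀ᵐ ω ∂P, m ω = 0 := by
  have hae : (fun ω => Real.exp (f ω + m ω * c)) =ᵐ[P] fun ω => Real.exp (f ω) := by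
    rcases le_total c 0 with hc | hc
    · refine (integral_eq_iff_of_ae_le hfm hf ?_).1 h
      filter_upwards [hm] with ω hω
      exact Real.exp_le_exp.2 (add_le_of_nonpos_right (mul_nonpos_of_nonneg_of_nonpos hω hc))
    · refine ((integral_eq_iff_of_ae_le hf hfm ?_).1 h.symm).symm
      filter_upwards [hm] with ω hω
      exact Real.exp_le_exp.2 (le_add_of_nonneg_right (mul_nonneg hω hc))
  filter_upwards [hae] with ω hω
  exact (mul_eq_zero.1 (add_eq_left.1 (Real.exp_injective hω))).resolve_right hc

theorem IsLevyProcess.integral_exp_increment [Fintype ι] (hX : IsLevyProcess P X)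
    {s u : ℝ≥0} (hsu : s ≤ u) (θ η : EuclideanSpace ℝ ι) :
    ∫ ω, Complex.exp ((inner ℝ (X s ω) θ + inner ℝ (X u ω - X s ω) η : ℝ) * Complex.I) ∂P =
      charFun (P.map (X s)) θ * charFun (P.map (X (u - s))) η := by
  have hinc := hX.identDistrib_increment hsu
  have hmul := ((hX.indepFun_increment hsu).comp
    (φ := fun x => Complex.exp ((inner ℝ x θ : ℝ) * Complex.I))
    (ψ := fun x => Complex.exp ((inner ℝ x η : ℝ) * Complex.I))
    (by fun_prop) (by fun_prop)).integral_fun_mul_eq_mul_integral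
      (Measurable.comp (by fun_prop) (hX.measurable s)).aestronglyMeasurable
      (Measurable.comp (by fun_prop)
        ((hX.measurable u).sub (hX.measurable s))).aestronglyMeasurable
  rw [← hinc.map_eq, charFun_map_eq_integral (hX.measurable s).aemeasurable,
    charFun_map_eq_integral hinc.aemeasurable_fst]
  simp only [Function.comp_apply] at hmul
  simp only [Complex.ofReal_add, add_mul, Complex.exp_add, hmul]

variable [DecidableEq ι] {g : EuclideanSpace ℝ ι → ℝ} {i j : ι}

/-- The exponent of `(X_i(τ_i), X_j(τ_j))` at `(a, b)` for a Lévy process `X` with real exponent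
`g`, arranged as that of a pair with independent components plus an interaction term. -/
def pairExponent (g : EuclideanSpace ℝ ι → ℝ) (i j : ι) (a b : ℝ) (τ : EuclideanSpace ℝ ι) : ℝ :=
  τ i * g (single i a) + τ j * g (single j b) +
    min (τ i) (τ j) * (g (single i a + single j b) - (g (single i a) + g (single j b)))

theorem pairExponent_comm (a b : ℝ) (τ : EuclideanSpace ℝ ι) :
    pairExponent g i j a b τ = pairExponent g j i b a τ := by
  rw [pairExponent, pairExponent, min_comm, add_comm (single i a)]
  ring

theorem pairExponent_self_zero (a : ℝ) (τ : EuclideanSpace ℝ ι) :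
    pairExponent g i i a 0 τ = τ i * g (single i a) := by
  have hzero : single i (0 : ℝ) = 0 := (PiLp.single_eq_zero_iff 2 i).2 rfl
  rw [pairExponent, hzero, add_zero, min_self]
  ring

theorem pairExponent_nonpos (hg : ∀ θ, g θ ≤ 0) {τ : EuclideanSpace ℝ ι} (hτ : ∀ k, 0 ≤ τ k)
    (a b : ℝ) : pairExponent g i j a b τ ≤ 0 := by
  have hcommon := mul_nonpos_of_nonneg_of_nonpos (le_min (hτ i) (hτ j))
    (hg (single i a + single j b))
  have hexcess_i := mul_nonpos_of_nonneg_of_nonpos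
    (sub_nonneg.2 (min_le_left (τ i) (τ j))) (hg (single i a))
  have hexcess_j := mul_nonpos_of_nonneg_of_nonpos
    (sub_nonneg.2 (min_le_right (τ i) (τ j))) (hg (single j b))
  rw [pairExponent]
  linarith

theorem measurable_pairExponent [Finite ι] (a b : ℝ) : Measurable (pairExponent g i j a b) := by
  unfold pairExponent
  fun_prop

variable [Fintype ι]

theorem IsLevyProcess.integral_exp_multiTime_of_le (hX : IsLevyProcess P X)
    (hg : HasCharExponent P X fun θ => g θ) {τ : EuclideanSpace ℝ ι} (hτ : ∀ k, 0 ≤ τ k)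
    (hij : τ i ≤ τ j) (a b : ℝ) :
    ∫ ω, Complex.exp ((inner ℝ (multiTime X τ ω) (single i a + single j b) : ℝ) * Complex.I) ∂P =
      Real.exp (pairExponent g i j a b τ) := by
  have hinner (ω : Ω) : inner ℝ (multiTime X τ ω) (single i a + single j b) =
      inner ℝ (X (τ i).toNNReal ω) (single i a + single j b) +
        inner ℝ (X (τ j).toNNReal ω - X (τ i).toNNReal ω) (single j b) := by
    simp only [inner_add_right, inner_sub_left, EuclideanSpace.inner_single_right, multiTime]
    ring
  have hle := Real.toNNReal_le_toNNReal hij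
  simp only [hinner]
  rw [hX.integral_exp_increment hle, hg, hg, NNReal.coe_sub hle, Real.coe_toNNReal _ (hτ i),
    Real.coe_toNNReal _ (hτ j), ← Complex.exp_add, Complex.ofReal_exp, pairExponent,
    min_eq_left hij]
  push_cast
  ring_nf

theorem IsLevyProcess.integral_exp_multiTime (hX : IsLevyProcess P X)
    (hg : HasCharExponent P X fun θ => g θ) {τ : EuclideanSpace ℝ ι} (hτ : ∀ k, 0 ≤ τ k)
    (a b : ℝ) :
    ∫ ω, Complex.exp ((inner ℝ (multiTime X τ ω) (single i a + single j b) : ℝ) * Complex.I) ∂P =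
      Real.exp (pairExponent g i j a b τ) := by
  rcases le_total (τ i) (τ j) with hij | hji
  · exact hX.integral_exp_multiTime_of_le hg hτ hij a b
  · rw [pairExponent_comm, add_comm (single i a)]
    exact hX.integral_exp_multiTime_of_le hg hτ hji b a

variable [IsProbabilityMeasure P]

theorem IsSubordinator.charFun_strongSub (hT : IsSubordinator P T) (hX : IsLevyProcess P X)
    (hTX : IndepFun (path T) (path X) P) (hg : HasCharExponent P X fun θ => g θ) (t : ℝ≥0)
    (a b : ℝ) :
    charFun (P.map (strongSub X T t)) (single i a + single j b) =
      (∫ ω, Real.exp (pairExponent g i j a b (T t ω)) ∂P : ℝ) := by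
  have hTt := hT.levy.measurable t
  have hpair := hX.aemeasurable_multiTime (P.map (T t))
  have hmeas := measurable_pairExponent (g := g) (i := i) (j := j) a b
  have : IsProbabilityMeasure (P.map (T t)) := Measure.isProbabilityMeasure_map hTt.aemeasurable
  have hint : Integrable (fun p => Complex.exp
      ((inner ℝ (multiTime X p.1 p.2) (single i a + single j b) : ℝ) * Complex.I))
      ((P.map (T t)).prod P) :=
    Integrable.of_bound (AEMeasurable.aestronglyMeasurable (by fun_prop)) 1
      (ae_of_all _ fun p => (Complex.norm_exp_ofReal_mul_I _).le)
  calc charFun (P.map (strongSub X T t)) (single i a + single j b)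
      = ∫ τ, ∫ ω, Complex.exp ((inner ℝ (multiTime X τ ω) (single i a + single j b) : ℝ) *
          Complex.I) ∂P ∂(P.map (T t)) := by
        rw [← (hX.identDistrib_strongSub hTX hTt).map_eq, charFun_map_eq_integral hpair,
          integral_prod _ hint]
    _ = ∫ τ, (Real.exp (pairExponent g i j a b τ) : ℂ) ∂(P.map (T t)) := by
        refine integral_congr_ae ?_
        filter_upwards [hT.ae_map_nonneg t] with τ hτ using hX.integral_exp_multiTime hg hτ a b
    _ = (∫ ω, Real.exp (pairExponent g i j a b (T t ω)) ∂P : ℝ) := by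
        rw [integral_complex_ofReal, integral_map hTt.aemeasurable
          (Measurable.aestronglyMeasurable (by fun_prop))]

theorem IsSubordinator.charFun_strongSub_single (hT : IsSubordinator P T)
    (hX : IsLevyProcess P X) (hTX : IndepFun (path T) (path X) P)
    (hg : HasCharExponent P X fun θ => g θ) (t : ℝ≥0) (k : ι) (a : ℝ) :
    charFun (P.map (strongSub X T t)) (single k a) =
      (∫ ω, Real.exp (T t ω k * g (single k a)) ∂P : ℝ) := by
  have h := hT.charFun_strongSub (i := k) (j := k) hX hTX hg t a 0
  simp only [pairExponent_self_zero] at h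
  have hzero : single k (0 : ℝ) = 0 := (PiLp.single_eq_zero_iff 2 k).2 rfl
  rwa [hzero, add_zero] at h

theorem IsSubordinator.integral_exp_pairExponent (hT : IsSubordinator P T)
    (hX : IsLevyProcess P X) (hTX : IndepFun (path T) (path X) P)
    (hg : HasCharExponent P X fun θ => g θ) {t : ℝ≥0}
    (hind : IndepFun (fun ω => T t ω i) (fun ω => T t ω j) P)
    (hsub : IndepFun (fun ω => strongSub X T t ω i) (fun ω => strongSub X T t ω j) P) (a b : ℝ) :
    ∫ ω, Real.exp (pairExponent g i j a b (T t ω)) ∂P =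
      ∫ ω, Real.exp (T t ω i * g (single i a) + T t ω j * g (single j b)) ∂P := by
  have hTt := hT.levy.measurable t
  have hexp := (hind.comp (φ := fun x => Real.exp (x * g (single i a)))
    (ψ := fun x => Real.exp (x * g (single j b))) (by fun_prop)
    (by fun_prop)).integral_fun_mul_eq_mul_integral
      (Measurable.aestronglyMeasurable (by fun_prop))
      (Measurable.aestronglyMeasurable (by fun_prop))
  have hmul := (indepFun_iff_charFun_single_add (U := strongSub X T t)
    (hX.aemeasurable_multiTime_comp hTt) i j).1 hsub a b
  rw [hT.charFun_strongSub hX hTX hg, hT.charFun_strongSub_single hX hTX hg,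
    hT.charFun_strongSub_single hX hTX hg, ← Complex.ofReal_mul, Complex.ofReal_inj] at hmul
  simp only [Function.comp_apply, ← Real.exp_add] at hexp
  rw [hmul, hexp]

theorem IsSubordinator.additiveAlong (hT : IsSubordinator P T)
    (hX : IsLevyProcess P X) (hTX : IndepFun (path T) (path X) P)
    (hg : HasCharExponent P X fun θ => g θ) {t : ℝ≥0}
    (hind : IndepFun (fun ω => T t ω i) (fun ω => T t ω j) P)
    (hsub : IndepFun (fun ω => strongSub X T t ω i) (fun ω => strongSub X T t ω j) P)
    (hmin : ¬ ∀ᵐ ω ∂P, min (T t ω i) (T t ω j) = 0) :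
    AdditiveAlong (fun θ => (g θ : ℂ)) i j := by
  intro a b
  have hTt := hT.levy.measurable t
  have hgneg := hg.real_nonpos (hX.measurable 1)
  have hmeas := measurable_pairExponent (g := g) (i := i) (j := j) a b
  have hpair := integrable_exp_of_ae_nonpos (hmeas.comp hTt) (P := P) <| by
    filter_upwards [hT.ae_nonneg] with ω hω using pairExponent_nonpos hgneg (hω t) a b
  have hprod : Integrable
      (fun ω => Real.exp (T t ω i * g (single i a) + T t ω j * g (single j b))) P := by
    refine integrable_exp_of_ae_nonpos (by fun_prop) ?_
    filter_upwards [hT.ae_nonneg] with ω hω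
    exact add_nonpos (mul_nonpos_of_nonneg_of_nonpos (hω t i) (hgneg _))
      (mul_nonpos_of_nonneg_of_nonpos (hω t j) (hgneg _))
  by_contra! hne
  refine hmin (ae_eq_zero_of_integral_exp_add_mul_eq hprod hpair ?_ ?_
    (hT.integral_exp_pairExponent hX hTX hg hind hsub a b))
  · filter_upwards [hT.ae_nonneg] with ω hω using le_min (hω t i) (hω t j)
  · exact fun h => hne (by exact_mod_cast sub_eq_zero.1 h)

end RealExponent

section Main

variable {Ω : Type*} [MeasurableSpace Ω] {P : Measure Ω} {ι : Type*} {i j : ι}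
  {X T : ℝ≥0 → Ω → EuclideanSpace ℝ ι}

theorem IsSubordinator.eventually_not_ae_eq_zero (hT : IsSubordinator P T) {k : ι}
    (hk : IsNontrivial P (component T k)) : ∀ᶠ t in atTop, ¬ ∀ᵐ ω ∂P, T t ω k = 0 := by
  have hex : ∃ n : ℕ, ¬ ∀ᵐ ω ∂P, T n ω k = 0 := by
    by_contra! hall
    refine hk ?_
    filter_upwards [ae_all_iff.2 hall, hT.ae_nonneg, hT.monotone] with ω hzero hnonneg hmono t
    obtain ⟨n, hn⟩ := exists_nat_ge t
    exact le_antisymm ((hmono k hn).trans (hzero n).le) (hnonneg t k)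
  obtain ⟨n, hn⟩ := hex
  filter_upwards [eventually_ge_atTop (n : ℝ≥0)] with t ht hzero
  refine hn ?_
  filter_upwards [hzero, hT.ae_nonneg, hT.monotone] with ω hzero hnonneg hmono
  exact le_antisymm ((hmono k ht).trans hzero.le) (hnonneg _ k)

theorem ae_eq_zero_or_ae_eq_zero_of_indepFun {U V : Ω → ℝ} (hUV : IndepFun U V P)
    (h : ∀ᵐ ω ∂P, U ω = 0 ∨ V ω = 0) : (∀ᵐ ω ∂P, U ω = 0) ∨ ∀ᵐ ω ∂P, V ω = 0 := by
  have hprod := hUV.measure_inter_preimage_eq_mul {0}ᶜ {0}ᶜ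
    (measurableSet_singleton _).compl (measurableSet_singleton _).compl
  have hzero : P (U ⁻¹' {0}ᶜ ∩ V ⁻¹' {0}ᶜ) = 0 := by
    refine measure_mono_null ?_ (ae_iff.1 h)
    exact fun ω hω hor => hor.elim hω.1 hω.2
  exact mul_eq_zero.1 (hprod.symm.trans hzero)

theorem IsSubordinator.exists_min_ne_zero (hT : IsSubordinator P T)
    (hind : ∀ t, IndepFun (fun ω => T t ω i) (fun ω => T t ω j) P)
    (hi : IsNontrivial P (component T i)) (hj : IsNontrivial P (component T j)) :
    ∃ t : ℝ≥0, 0 < t ∧ ¬ ∀ᵐ ω ∂P, min (T t ω i) (T t ω j) = 0 := by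
  obtain ⟨t, ht, hti, htj⟩ := ((eventually_gt_atTop 0).and
    ((hT.eventually_not_ae_eq_zero hi).and (hT.eventually_not_ae_eq_zero hj))).exists
  refine ⟨t, ht, fun hmin => (ae_eq_zero_or_ae_eq_zero_of_indepFun (hind t) ?_).elim hti htj⟩
  filter_upwards [hmin] with ω hω
  exact (min_choice (T t ω i) (T t ω j)).imp (fun h => h.symm.trans hω) fun h => h.symm.trans hω

theorem indepFun_apply_of_identDistrib [Finite ι] [IsProbabilityMeasure P] {Ω' : Type*}
    [MeasurableSpace Ω'] {R : Measure Ω'} [IsProbabilityMeasure R] {U : Ω → EuclideanSpace ℝ ι}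
    {V : Ω' → EuclideanSpace ℝ ι} (hUV : IdentDistrib U V P R)
    (hV : IndepFun (fun ω => V ω i) (fun ω => V ω j) R) :
    IndepFun (fun ω => U ω i) (fun ω => U ω j) P := by
  classical
  have := Fintype.ofFinite ι
  rw [indepFun_iff_charFun_single_add hUV.aemeasurable_fst, hUV.map_eq]
  exact (indepFun_iff_charFun_single_add hUV.aemeasurable_snd i j).1 hV

theorem indepFun_component_of_identDistrib [IsProbabilityMeasure P] {Ω' Ω'' : Type*}
    [MeasurableSpace Ω'] [MeasurableSpace Ω''] {Q : Measure Ω'} {R : Measure Ω''}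
    [IsProbabilityMeasure R] {n : ℕ} {i j : Fin n} {T X : ℝ≥0 → Ω → EuclideanSpace ℝ (Fin n)}
    {Y : ℝ≥0 → Ω' → EuclideanSpace ℝ (Fin n)}
    {Z : ℝ≥0 → Ω'' → EuclideanSpace ℝ (Fin n ⊕ Fin n)}
    (hT : IsSubordinator P T) (hTX : IndepFun (path T) (path X) P)
    (hZ : IsWeakSubordination P T X R Z) (hYZ : IdentDistrib (path Y) (path (second Z)) Q R)
    (hsymm : IdentDistrib (path X) (path fun t ω => -X t ω) P P)
    (hind : IndepFun (path (component T i)) (path (component T j)) P)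
    (hdrift : ∀ k, IsDriftless P (scalar (component T k)))
    (hnt : ∀ k, IsNontrivial P (component T k))
    (hid : ∀ t : ℝ≥0, 0 < t → IdentDistrib (strongSub X T t) (Y t) P Q) :
    IndepFun (path (component X i)) (path (component X j)) P := by
  have hindt (t : ℝ≥0) : IndepFun (fun ω => T t ω i) (fun ω => T t ω j) P :=
    hind.comp (φ := fun f : ℝ≥0 → ℝ => f t) (ψ := fun f : ℝ≥0 → ℝ => f t) (by fun_prop)
      (by fun_prop)
  have heval (t : ℝ≥0) : Measurable fun f : ℝ≥0 → EuclideanSpace ℝ (Fin n) => f t :=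
    measurable_pi_apply (X := fun _ : ℝ≥0 => EuclideanSpace ℝ (Fin n)) t
  obtain ⟨_, _, _, _, _, _, hX, _⟩ := id hZ
  obtain ⟨g, hg⟩ := hX.hasCharExponent.exists_real hX.levy.measurable
    fun t => hsymm.comp (heval t)
  obtain ⟨t, ht, hmin⟩ := hT.exists_min_ne_zero hindt (hnt i) (hnt j)
  have hlaw : IdentDistrib (strongSub X T t) (second Z t) P R :=
    (hid t ht).trans (hYZ.comp (heval t))
  have hsub := indepFun_apply_of_identDistrib hlaw (hZ.indepFun_second hindt hdrift t)
  exact hX.levy.indepFun_component <| (hg.forall_indepFun_iff hX.levy.measurable).2 <|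
    hT.additiveAlong hX.levy hTX hg (hindt t) hsub hmin

end Main

end WeakSubordination

end

theorem proposition3p10
    {Ω : Type*} [MeasurableSpace Ω] (P : Measure Ω) [IsProbabilityMeasure P]
    {Ω' : Type*} [MeasurableSpace Ω'] (Q : Measure Ω') [IsProbabilityMeasure Q]
    (T X : ℝ≥0 → Ω → EuclideanSpace ℝ (Fin 2))
    (Y : ℝ≥0 → Ω' → EuclideanSpace ℝ (Fin 2))
    (hT : WeakSubordination.IsSubordinator P T)
    (hX : WeakSubordination.IsLevyProcess P X)
    (hY : WeakSubordination.IsLevyProcess Q Y)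
    (hTX : IndepFun (WeakSubordination.path T) (WeakSubordination.path X) P)
    (hdep : ¬ IndepFun (WeakSubordination.path (WeakSubordination.component X 0))
      (WeakSubordination.path (WeakSubordination.component X 1)) P) :
    (MemLp (T 1) 2 P → MemLp (X 1) 2 P →
      cov[fun ω => X 1 ω 0, fun ω => X 1 ω 1; P] ≠ 0 →
      ¬ WeakSubordination.HasMonotonicComponents P T →
      ∃ t : ℝ≥0, 0 < t ∧ ¬ IdentDistrib (WeakSubordination.strongSub X T t) (Y t) P Q) ∧
    (∀ {Ω'' : Type*} [MeasurableSpace Ω''] (R : Measure Ω'') [IsProbabilityMeasure R]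
      (Z : ℝ≥0 → Ω'' → EuclideanSpace ℝ (Fin 2 ⊕ Fin 2)),
      WeakSubordination.IsWeakSubordination P T X R Z →
      IdentDistrib (WeakSubordination.path Y)
        (WeakSubordination.path (WeakSubordination.second Z)) Q R →
      IdentDistrib (WeakSubordination.path X)
        (WeakSubordination.path fun t ω => -X t ω) P P →
      IndepFun (WeakSubordination.path (WeakSubordination.component T 0))
        (WeakSubordination.path (WeakSubordination.component T 1)) P →
      (∀ k, WeakSubordination.IsDriftless P
        (WeakSubordination.scalar (WeakSubordination.component T k))) →
      (∀ k, WeakSubordination.IsNontrivial P (WeakSubordination.component T k)) →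
      ∃ t : ℝ≥0, 0 < t ∧ ¬ IdentDistrib (WeakSubordination.strongSub X T t) (Y t) P Q) := by
  refine ⟨fun hT1 hX1 hcov hmono => ?_, fun R _ Z hZ hYZ hsymm hind hdrift hnt => ?_⟩
  · by_contra! h
    exact hmono (WeakSubordination.hasMonotonicComponents_of_identDistrib hT hX hY hTX hT1 hX1
      hcov h)
  · by_contra! h
    exact hdep (WeakSubordination.indepFun_component_of_identDistrib hT hTX hZ hYZ hsymm hind
      hdrift hnt h)
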